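/- **Setting.** Let $\kappa$ be a field and $\Gamma<\mathbb{R}$ a finitely generated additive subgroup. Let $\Lambda=\kappa[\Gamma]$ be the group algebra, with elements the finite sums $\sum_{g\in\Gamma}a_gT^g$, $a_g\in\kappa$. Let $\Lambda_\uparrow\supseteq\Lambda$ (resp. $\Lambda^\downarrow\supseteq\Lambda$) be the field of formal sums $\sum_{g\in\Gamma}a_gT^g$ such that for every $C\in\mathbb{R}$ only finitely many $g<C$ (resp. $g>-C$) have $a_g\ne0$. Put $\nu_\uparrow(\sum a_gT^g)=\min\{g: a_g\neq0\}$ on $\Lambda_\uparrow$ and $\nu^\downarrow(\sum a_gT^g)=\max\{g: a_g\neq 0\}$ on $\Lambda^\downarrow$, with $\nu_\uparrow(0)=\infty$ and $\nu^\downarrow(0)=-\infty$. A normed $\Lambda_\uparrow$-space is a finite-dimensional $\Lambda_\uparrow$-vector space $V_\uparrow$ with a function $\rho_\uparrow:V_\uparrow\to\mathbb{R}\cup\{-\infty\}$ such that $\rho_\uparrow(x)=-\infty$ iff $x=0$, $\rho_\uparrow(\lambda x)=\rho_\uparrow(x)-\nu_\uparrow(\lambda)$, and $\rho_\uparrow(x+y)\le\max\{\rho_\uparrow(x),\rho_\uparrow(y)\}$.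 A basis $(x_i)$ of it is *orthogonal* if $\rho_\uparrow(\sum\lambda_ix_i)=\max_i(\rho_\uparrow(x_i)-\nu_\uparrow(\lambda_i))$ for all $\lambda_i\in\Lambda_\uparrow$. A normed $\Lambda^\downarrow$-space is a finite-dimensional $\Lambda^\downarrow$-vector space $V^\downarrow$ with a function $\rho^\downarrow:V^\downarrow\to\mathbb{R}\cup\{\infty\}$ such that $\rho^\downarrow(x)=\infty$ iff $x=0$, $\rho^\downarrow(\lambda x)=\rho^\downarrow(x)-\nu^\downarrow(\lambda)$, and $\rho^\downarrow(x+y)\ge\min\{\rho^\downarrow(x),\rho^\downarrow(y)\}$. A basis $(x_i)$ of it is *orthogonal* if $\rho^\downarrow(\sum\lambda_ix_i)=\min_i(\rho^\downarrow(x_i)-\nu^\downarrow(\lambda_i))$ for all $\lambda_i\in\Lambda^\downarrow$. A *filtered matched pair* $\mathcal{P}$ consists of a finitely generated $\Lambda$-module $H$, a normed $\Lambda_\uparrow$-space $(V_\uparrow,\rho_\uparrow)$, a normed $\Lambda^\downarrow$-space $(V^\downarrow,\rho^\downarrow)$, and $\Lambda$-linear maps $\phi_\uparrow:H\to V_\uparrow$,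 $\phi^\downarrow:H\to V^\downarrow$ whose extensions $\Lambda_\uparrow\otimes_\Lambda H\to V_\uparrow$ and $\Lambda^\downarrow\otimes_\Lambda H\to V^\downarrow$ are isomorphisms. Let $\mathcal{Q}(\Lambda)$ be the fraction field of $\Lambda$ and $d=\dim_{\mathcal{Q}(\Lambda)}\mathcal{Q}(\Lambda)\otimes_\Lambda H$; elements of $H$ are *independent* if they become linearly independent in $\mathcal{Q}(\Lambda)\otimes_\Lambda H$. For $1\le i\le d$ the $i$-th *gap* $G_i(\mathcal{P})$ is the supremum of all $\gamma\in\mathbb{R}$ for which there are independent $x_1,\dots,x_i\in H$ with $\rho^\downarrow(\phi^\downarrow x_j)-\rho_\uparrow(\phi_\uparrow x_j)\ge\gamma$ for all $j$. A *doubly-orthogonal basis* of $\mathcal{P}$ is a family $e_1,\dots,e_d\in H$ that projects to a $\Lambda$-basis of $H/tH$ ($tH$ the torsion submodule), such that $(\phi_\uparrow e_i)$ and $(\phi^\downarrow e_i)$ are orthogonal bases of $V_\uparrow$ and $V^\downarrow$. If such a basis exists, the *basis spectrum* $\Sigma(\mathcal{P})$ is the multiset of the pairs $\big([\rho_\uparrow(\phi_\uparrow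 e_i)],\ \rho^\downarrow(\phi^\downarrow e_i)-\rho_\uparrow(\phi_\uparrow e_i)\big)\in(\mathbb{R}/\Gamma)\times\mathbb{R}$, $1\le i\le d$. **Theorem.** Let $\mathcal{P}$ and $\hat{\mathcal{P}}$ be filtered matched pairs with the same $H,V_\uparrow,V^\downarrow,\phi_\uparrow,\phi^\downarrow$ and with filtration functions $\rho_\uparrow,\rho^\downarrow$ and $\hat\rho_\uparrow,\hat\rho^\downarrow$ respectively, and let $t\in\mathbb{R}$ be such that $|\rho_\uparrow-\hat\rho_\uparrow|\le t$ on $V_\uparrow\setminus\{0\}$ and $|\rho^\downarrow-\hat\rho^\downarrow|\le t$ on $V^\downarrow\setminus\{0\}$. Then for every $1\le i\le d$ the suprema $G_i(\mathcal{P})$ and $G_i(\hat{\mathcal{P}})$ are real numbers, and $$|G_i(\mathcal{P})-G_i(\hat{\mathcal{P}})|\le 2t.$$ If moreover $\Gamma$ is discrete, then $\mathcal{P}$ and $\hat{\mathcal{P}}$ have doubly-orthogonal bases, the basis spectra $\Sigma(\mathcal{P})$ and $\Sigma(\hat{\mathcal{P}})$ do not depend on the choice of these bases, and there is a bijection of multisets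 $\sigma:\Sigma(\mathcal{P})\to\Sigma(\hat{\mathcal{P}})$ such that, for every $([a],\ell)\in\Sigma(\mathcal{P})$, the image $([\hat a],\hat\ell)=\sigma([a],\ell)$ satisfies, for some choice of $\hat a$ within its $\Gamma$-coset, $$|\hat a-a|\le t\quad\text{and}\quad|(\hat a+\hat\ell)-(a+\ell)|\le t.$$ -/

import Mathlib

open scoped TensorProduct

noncomputable section

namespace FMP

/-! ### The group algebra and the two Novikov rings of a subgroup `Γ` of `ℝ` -/

/-- Formal series `∑ a_g T^g` over `G`, with the convolution product of Hahn series, such that for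
every real `C` only finitely many `g` with `a_g ≠ 0` satisfy `w g < C`. -/
def finiteBelow (κ : Type*) [Field κ] (G : Type*) [AddCommGroup G] [LinearOrder G]
    [IsOrderedAddMonoid G] (w : G →+ ℝ) : Subalgebra κ (HahnSeries G κ) where
  carrier := {x | ∀ C : ℝ, {g : G | x.coeff g ≠ 0 ∧ w g < C}.Finite}
  algebraMap_mem' r C := by
    refine (Set.finite_singleton (0 : G)).subset ?_
    rintro g ⟨hg, -⟩
    by_contra h
    exact hg (by rw [HahnSeries.algebraMap_apply]; exact HahnSeries.coeff_single_of_ne h)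
  add_mem' {x y} hx hy C := by
    refine ((hx C).union (hy C)).subset ?_
    rintro g ⟨hg, hC⟩
    by_cases h : x.coeff g = 0
    · exact Or.inr ⟨fun h' => hg (by simp [h, h']), hC⟩
    · exact Or.inl ⟨h, hC⟩
  mul_mem' {x y} hx hy C := by
    have bdd : ∀ z : HahnSeries G κ, (∀ C : ℝ, {g : G | z.coeff g ≠ 0 ∧ w g < C}.Finite) →
        ∃ m : ℝ, ∀ g, z.coeff g ≠ 0 → m ≤ w g := by
      intro z hz
      obtain ⟨m, hm⟩ := ((hz 0).image w).bddBelow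
      refine ⟨min m 0, fun g hg => ?_⟩
      rcases lt_or_ge (w g) 0 with h | h
      · exact (min_le_left _ _).trans (hm ⟨g, ⟨hg, h⟩, rfl⟩)
      · exact (min_le_right _ _).trans h
    obtain ⟨mx, hmx⟩ := bdd x hx
    obtain ⟨my, hmy⟩ := bdd y hy
    refine (((hx (C - my)).prod (hy (C - mx))).image (fun p : G × G => p.1 + p.2)).subset ?_
    rintro g ⟨hg, hC⟩
    obtain ⟨a, ha, b, hb, rfl⟩ := Set.mem_add.1 (HahnSeries.support_mul_subset hg)
    have h1 := hmx a ha
    have h2 := hmy b hb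
    rw [map_add] at hC
    exact ⟨(a, b), ⟨⟨ha, by linarith⟩, ⟨hb, by linarith⟩⟩, rfl⟩

variable (κ : Type*) [Field κ] (Γ : AddSubgroup ℝ)

/-- The group algebra `Λ = κ[Γ]`. -/
abbrev Lam : Type _ := AddMonoidAlgebra κ Γ

/-- `g ↦ g` as a homomorphism `Γ → ℝ`. -/
def heightUp : Γ →+ ℝ := Γ.subtype

/-- `g ↦ -g` as a homomorphism `Γᵒᵈ → ℝ`. -/
def heightDown : (Γ)ᵒᵈ →+ ℝ where
  toFun g := -((OrderDual.ofDual g : Γ) : ℝ)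
  map_zero' := by simp
  map_add' a b := by simp [add_comm]

/-- The Novikov field `Λ_↑`: formal series `∑_{g ∈ Γ} a_g T^g` such that for every `C` only
finitely many `g < C` have `a_g ≠ 0`. -/
def LamUp : Type _ := finiteBelow κ Γ (heightUp Γ)

/-- The Novikov field `Λ^↓`: formal series `∑_{g ∈ Γ} a_g T^g` such that for every `C` only
finitely many `g > -C` have `a_g ≠ 0`. The exponents are ordered by the reverse of the order
of `ℝ`. -/
def LamDown : Type _ := finiteBelow κ (Γ)ᵒᵈ (heightDown Γ)

instance : CommRing (LamUp κ Γ) := inferInstanceAs (CommRing (finiteBelow κ Γ (heightUp Γ)))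
instance : Algebra κ (LamUp κ Γ) := inferInstanceAs (Algebra κ (finiteBelow κ Γ (heightUp Γ)))
instance : CommRing (LamDown κ Γ) :=
  inferInstanceAs (CommRing (finiteBelow κ (Γ)ᵒᵈ (heightDown Γ)))
instance : Algebra κ (LamDown κ Γ) :=
  inferInstanceAs (Algebra κ (finiteBelow κ (Γ)ᵒᵈ (heightDown Γ)))

variable {κ Γ}

/-- The coefficient `a_g` of `∑ a_g T^g ∈ Λ_↑`. -/
def LamUp.coeff (x : LamUp κ Γ) (g : Γ) : κ := x.1.coeff g

/-- The coefficient `a_g` of `∑ a_g T^g ∈ Λ^↓`. -/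
def LamDown.coeff (x : LamDown κ Γ) (g : Γ) : κ := x.1.coeff (OrderDual.toDual g)

theorem single_mem_finiteBelow {G : Type*} [AddCommGroup G] [LinearOrder G]
    [IsOrderedAddMonoid G] (w : G →+ ℝ) (g : G) (r : κ) :
    HahnSeries.single g r ∈ finiteBelow κ G w := by
  intro C
  refine (Set.finite_singleton g).subset ?_
  rintro h ⟨hh, -⟩
  by_contra hne
  exact hh (HahnSeries.coeff_single_of_ne hne)

variable (κ Γ)

/-- The monomials `T^g` in `Λ_↑`. -/
def monomialUp : Multiplicative Γ →* LamUp κ Γ where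
  toFun g := ⟨HahnSeries.single g.toAdd 1, single_mem_finiteBelow _ _ _⟩
  map_one' := rfl
  map_mul' a b := Subtype.ext (by
    refine Eq.symm ((HahnSeries.single_mul_single).trans ?_)
    simp)

/-- The monomials `T^g` in `Λ^↓`. -/
def monomialDown : Multiplicative Γ →* LamDown κ Γ where
  toFun g := ⟨HahnSeries.single (OrderDual.toDual g.toAdd) 1, single_mem_finiteBelow _ _ _⟩
  map_one' := rfl
  map_mul' a b := Subtype.ext (by
    refine Eq.symm ((HahnSeries.single_mul_single).trans ?_)
    simp)

/-- The inclusion `Λ ⊆ Λ_↑`, `∑ a_g T^g ↦ ∑ a_g T^g`, makes `Λ_↑` a `Λ`-algebra. -/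
instance : Algebra (Lam κ Γ) (LamUp κ Γ) :=
  (AddMonoidAlgebra.lift κ (LamUp κ Γ) Γ (monomialUp κ Γ)).toRingHom.toAlgebra

/-- The inclusion `Λ ⊆ Λ^↓`, `∑ a_g T^g ↦ ∑ a_g T^g`, makes `Λ^↓` a `Λ`-algebra. -/
instance : Algebra (Lam κ Γ) (LamDown κ Γ) :=
  (AddMonoidAlgebra.lift κ (LamDown κ Γ) Γ (monomialDown κ Γ)).toRingHom.toAlgebra

variable {κ Γ}

/-- `ν_↑(∑ a_g T^g) = min {g | a_g ≠ 0}`, with value `∞` at `0`. -/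
def nuUp (x : LamUp κ Γ) : EReal := ⨅ (g : Γ) (_ : x.coeff g ≠ 0), ((g : ℝ) : EReal)

/-- `ν^↓(∑ a_g T^g) = max {g | a_g ≠ 0}`, with value `-∞` at `0`. -/
def nuDown (x : LamDown κ Γ) : EReal := ⨆ (g : Γ) (_ : x.coeff g ≠ 0), ((g : ℝ) : EReal)

/-! ### Normed spaces and orthogonal bases -/

/-- The function `ρ : V → ℝ ∪ {-∞}` makes `V` a normed `Λ_↑`-space (`V` itself being
finite-dimensional). -/
structure IsNormUp {V : Type*} [AddCommGroup V] [Module (LamUp κ Γ) V] (ρ : V → EReal) :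
    Prop where
  ne_top : ∀ x, ρ x ≠ ⊤
  eq_bot_iff : ∀ x, ρ x = ⊥ ↔ x = 0
  smul : ∀ (c : LamUp κ Γ) (x : V), ρ (c • x) = ρ x - nuUp c
  add_le : ∀ x y, ρ (x + y) ≤ max (ρ x) (ρ y)

/-- The function `ρ : V → ℝ ∪ {∞}` makes `V` a normed `Λ^↓`-space (`V` itself being
finite-dimensional). -/
structure IsNormDown {V : Type*} [AddCommGroup V] [Module (LamDown κ Γ) V] (ρ : V → EReal) :
    Prop where
  ne_bot : ∀ x, ρ x ≠ ⊥
  eq_top_iff : ∀ x, ρ x = ⊤ ↔ x = 0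
  smul : ∀ (c : LamDown κ Γ) (x : V), ρ (c • x) = ρ x - nuDown c
  le_add : ∀ x y, min (ρ x) (ρ y) ≤ ρ (x + y)

/-- `x_1, …, x_k` is a `ρ`-orthogonal basis of the normed `Λ_↑`-space `(V, ρ)`. -/
structure IsOrthogonalBasisUp {V : Type*} [AddCommGroup V] [Module (LamUp κ Γ) V]
    (ρ : V → EReal) {k : ℕ} (x : Fin k → V) : Prop where
  linearIndependent : LinearIndependent (LamUp κ Γ) x
  span_eq_top : Submodule.span (LamUp κ Γ) (Set.range x) = ⊤
  orthogonal : ∀ c : Fin k → LamUp κ Γ,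
    ρ (∑ i, c i • x i) = Finset.univ.sup fun i => ρ (x i) - nuUp (c i)

/-- `x_1, …, x_k` is a `ρ`-orthogonal basis of the normed `Λ^↓`-space `(V, ρ)`. -/
structure IsOrthogonalBasisDown {V : Type*} [AddCommGroup V] [Module (LamDown κ Γ) V]
    (ρ : V → EReal) {k : ℕ} (x : Fin k → V) : Prop where
  linearIndependent : LinearIndependent (LamDown κ Γ) x
  span_eq_top : Submodule.span (LamDown κ Γ) (Set.range x) = ⊤
  orthogonal : ∀ c : Fin k → LamDown κ Γ,
    ρ (∑ i, c i • x i) = Finset.univ.inf fun i => ρ (x i) - nuDown (c i)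

end FMP

/-! ### Filtered matched pairs -/

/-- A filtered matched pair `(V_↑, ρ_↑) ← H → (V^↓, ρ^↓)`. The conditions `IsBaseChange` say that
`Λ_↑ ⊗_Λ H → V_↑` and `Λ^↓ ⊗_Λ H → V^↓` are isomorphisms. -/
structure FilteredMatchedPair (κ : Type*) [Field κ] (Γ : AddSubgroup ℝ)
    (H Vup Vdown : Type*)
    [AddCommGroup H] [Module (FMP.Lam κ Γ) H] [Module.Finite (FMP.Lam κ Γ) H]
    [AddCommGroup Vup] [Module (FMP.Lam κ Γ) Vup] [Module (FMP.LamUp κ Γ) Vup]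
    [IsScalarTower (FMP.Lam κ Γ) (FMP.LamUp κ Γ) Vup] [Module.Finite (FMP.LamUp κ Γ) Vup]
    [AddCommGroup Vdown] [Module (FMP.Lam κ Γ) Vdown] [Module (FMP.LamDown κ Γ) Vdown]
    [IsScalarTower (FMP.Lam κ Γ) (FMP.LamDown κ Γ) Vdown]
    [Module.Finite (FMP.LamDown κ Γ) Vdown] where
  /-- the map `φ_↑` -/
  phiUp : H →ₗ[FMP.Lam κ Γ] Vup
  /-- the map `φ^↓` -/
  phiDown : H →ₗ[FMP.Lam κ Γ] Vdown
  /-- the filtration function `ρ_↑` -/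
  rhoUp : Vup → EReal
  /-- the filtration function `ρ^↓` -/
  rhoDown : Vdown → EReal
  isBaseChange_up : IsBaseChange (FMP.LamUp κ Γ) phiUp
  isBaseChange_down : IsBaseChange (FMP.LamDown κ Γ) phiDown
  isNormUp : FMP.IsNormUp (κ := κ) (Γ := Γ) rhoUp
  isNormDown : FMP.IsNormDown (κ := κ) (Γ := Γ) rhoDown

namespace FMP

/-- Independence of a finite family in a `Λ`-module: linear independence after tensoring with the
fraction field of `Λ`. -/
def Independent (κ : Type*) [Field κ] (Γ : AddSubgroup ℝ) {H : Type*} [AddCommGroup H]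
    [Module (Lam κ Γ) H] {k : ℕ} (x : Fin k → H) : Prop :=
  LinearIndependent (FractionRing (Lam κ Γ))
    (fun j => (1 : FractionRing (Lam κ Γ)) ⊗ₜ[Lam κ Γ] x j)

/-- `d = dim_{Q(Λ)} (Q(Λ) ⊗_Λ H)`, with `Q(Λ)` the fraction field of `Λ`. -/
def rank (κ : Type*) [Field κ] (Γ : AddSubgroup ℝ) (H : Type*) [AddCommGroup H]
    [Module (Lam κ Γ) H] : ℕ :=
  Module.finrank (FractionRing (Lam κ Γ)) (FractionRing (Lam κ Γ) ⊗[Lam κ Γ] H)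

end FMP

namespace FilteredMatchedPair

open FMP

variable {κ : Type*} [Field κ] {Γ : AddSubgroup ℝ} {H Vup Vdown : Type*}
    [AddCommGroup H] [Module (Lam κ Γ) H] [Module.Finite (Lam κ Γ) H]
    [AddCommGroup Vup] [Module (Lam κ Γ) Vup] [Module (LamUp κ Γ) Vup]
    [IsScalarTower (Lam κ Γ) (LamUp κ Γ) Vup] [Module.Finite (LamUp κ Γ) Vup]
    [AddCommGroup Vdown] [Module (Lam κ Γ) Vdown] [Module (LamDown κ Γ) Vdown]
    [IsScalarTower (Lam κ Γ) (LamDown κ Γ) Vdown] [Module.Finite (LamDown κ Γ) Vdown]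

/-- The set of real numbers whose supremum is the `i`-th gap. -/
def gapSet (P : FilteredMatchedPair κ Γ H Vup Vdown) (i : ℕ) : Set ℝ :=
  {γ | ∃ x : Fin i → H, Independent κ Γ x ∧
    ∀ j, (γ : EReal) ≤ P.rhoDown (P.phiDown (x j)) - P.rhoUp (P.phiUp (x j))}

/-- The `i`-th gap `G_i(P)`, for `1 ≤ i ≤ d`. -/
def gap (P : FilteredMatchedPair κ Γ H Vup Vdown) (i : ℕ) : ℝ := sSup (P.gapSet i)

/-- `e_1, …, e_d` is a doubly-orthogonal basis of `P`: it projects to a basis of the `Λ`-module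
`H / tH`, with `tH` the torsion submodule, and its images in `V_↑` and in `V^↓` are orthogonal
bases. -/
structure IsDoublyOrthogonalBasis (P : FilteredMatchedPair κ Γ H Vup Vdown)
    (e : Fin (rank κ Γ H) → H) : Prop where
  linearIndependent : LinearIndependent (Lam κ Γ)
    (fun i => (Submodule.torsion (Lam κ Γ) H).mkQ (e i))
  span_eq_top : Submodule.span (Lam κ Γ)
    (Set.range fun i => (Submodule.torsion (Lam κ Γ) H).mkQ (e i)) = ⊤
  up : IsOrthogonalBasisUp (κ := κ) (Γ := Γ) P.rhoUp (fun i => P.phiUp (e i))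
  down : IsOrthogonalBasisDown (κ := κ) (Γ := Γ) P.rhoDown (fun i => P.phiDown (e i))

/-- The multiset of the pairs `([ρ_↑(φ_↑ e_i)], ρ^↓(φ^↓ e_i) - ρ_↑(φ_↑ e_i))` in `(ℝ / Γ) × ℝ`. -/
def spectrumOf (P : FilteredMatchedPair κ Γ H Vup Vdown) (e : Fin (rank κ Γ H) → H) :
    Multiset ((ℝ ⧸ Γ) × ℝ) :=
  (Finset.univ : Finset (Fin (rank κ Γ H))).val.map fun i =>
    (((P.rhoUp (P.phiUp (e i))).toReal : ℝ ⧸ Γ),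
      (P.rhoDown (P.phiDown (e i))).toReal - (P.rhoUp (P.phiUp (e i))).toReal)

open Classical in
/-- The basis spectrum `Σ(P)`: the spectrum of some doubly-orthogonal basis of `P`, if there is
one (and a default value otherwise). -/
def basisSpectrum (P : FilteredMatchedPair κ Γ H Vup Vdown) : Multiset ((ℝ ⧸ Γ) × ℝ) :=
  if h : ∃ e, P.IsDoublyOrthogonalBasis e then P.spectrumOf h.choose else 0

/-- The basis spectrum of `P` is well-defined: there is a doubly-orthogonal basis, and every
doubly-orthogonal basis has the spectrum `Σ(P)`. -/
def HasBasisSpectrum (P : FilteredMatchedPair κ Γ H Vup Vdown) : Prop :=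
  (∃ e, P.IsDoublyOrthogonalBasis e) ∧
    ∀ e, P.IsDoublyOrthogonalBasis e → P.spectrumOf e = P.basisSpectrum

end FilteredMatchedPair

namespace FMP

/-- `p = ([a], ℓ)` and `q = ([a'], ℓ')` are `t`-close: for every representative `a` there is a
representative `a'` with `|a' - a| ≤ t` and `|(a' + ℓ') - (a + ℓ)| ≤ t`. -/
def Close {Γ : AddSubgroup ℝ} (t : ℝ) (p q : (ℝ ⧸ Γ) × ℝ) : Prop :=
  ∀ a : ℝ, (a : ℝ ⧸ Γ) = p.1 →
    ∃ a' : ℝ, (a' : ℝ ⧸ Γ) = q.1 ∧ |a' - a| ≤ t ∧ |(a' + q.2) - (a + p.2)| ≤ t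

end FMP

end

/-! Negating `ν^↓` and `ρ^↓` turns the descending side into an ascending one whose exponent `g` has
height `-g`. Both sides are then instances of one situation (`IsNovikov`, `IsSize`) with opposite
height functions, and each argument is made once.

Gaps. The only real point is that the gap sets are bounded above. A linear functional on a
finite-dimensional normed space over a complete valued field is bounded. A non-torsion `x` has
nonzero image `f x` under one of finitely many functionals `H → Λ`. An exponent `g` of `f x` bounds
`ρ_↑` below by about `-g` and `ρ^↓` above by about `-g`, so their difference is bounded above
uniformly in `x` (`exists_size_bound`). Stability is then immediate: the same independent family
serves for both filtrations, with a loss of at most `2t`.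

Existence of doubly-orthogonal bases. For discrete `Γ`, `Λ` is a PID and `H / tH` is free. Lift a
basis so that the total of `ρ_↑ - ρ^↓` is least. The minimum is attained because the totals are
bounded below and lie in finitely many cosets of `Γ`. If orthogonality failed on one side,
cancelling leading terms would improve one basis vector on that side without spoiling it on the
other (`exists_improvement`), contradicting minimality.

Spectra. Let `A` and `B` be the mutually inverse change-of-basis matrices between doubly-orthogonal
bases of the two pairs. A nonzero entry gives one-sided inequalities between both levels of the two
basis vectors. If neither `e i` nor `e i'` is close to `f j`, although `A j i` and `B i' j` are
nonzero, these inequalities force `ℓ_i < ℓ_{i'}`. Hence close pairs satisfy a Hall-type condition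
(`exists_perm_forall_mem`), and a perfect matching exists. The case `t = 0` is independence of the
basis. -/

namespace FMP

/-! ### The valuation of the ring of finite-below series -/

section FiniteBelow

variable {κ : Type*} [Field κ] {G : Type*} [AddCommGroup G] [LinearOrder G]
  [IsOrderedAddMonoid G] {w : G →+ ℝ}

/-- The least height of an exponent of `x`, with value `∞` at `0`. -/
noncomputable def val (x : finiteBelow κ G w) : EReal :=
  ⨅ (g : G) (_ : x.1.coeff g ≠ 0), ((w g : ℝ) : EReal)

theorem le_val_iff {x : finiteBelow κ G w} {s : EReal} :
    s ≤ val x ↔ ∀ g, x.1.coeff g ≠ 0 → s ≤ ((w g : ℝ) : EReal) := by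
  simp [val, le_iInf_iff]

theorem val_le {x : finiteBelow κ G w} {g : G} (h : x.1.coeff g ≠ 0) : val x ≤ w g :=
  le_val_iff.1 le_rfl g h

theorem exists_val_eq {x : finiteBelow κ G w} (hx : x ≠ 0) :
    ∃ g, x.1.coeff g ≠ 0 ∧ val x = w g := by
  obtain ⟨g₀, hg₀⟩ : ∃ g, x.1.coeff g ≠ 0 := by
    by_contra! h
    exact hx (Subtype.ext (HahnSeries.ext (funext h)))
  obtain ⟨g, ⟨hg, hg1⟩, hmin⟩ := Set.exists_min_image _ w (x.2 (w g₀ + 1))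
    ⟨g₀, hg₀, lt_add_one _⟩
  refine ⟨g, hg, le_antisymm (val_le hg) (le_val_iff.2 fun h hh => ?_)⟩
  rw [EReal.coe_le_coe_iff]
  rcases lt_or_ge (w h) (w g₀ + 1) with h1 | h1
  · exact hmin h ⟨hh, h1⟩
  · exact hg1.le.trans h1

theorem val_zero : val (0 : finiteBelow κ G w) = ⊤ :=
  top_le_iff.1 (le_val_iff.2 fun _ h => absurd rfl h)

theorem val_eq_top_iff {x : finiteBelow κ G w} : val x = ⊤ ↔ x = 0 := by
  refine ⟨fun h => ?_, fun h => h ▸ val_zero⟩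
  by_contra hx
  obtain ⟨g, -, hg⟩ := exists_val_eq hx
  exact EReal.coe_ne_top _ (hg.symm.trans h)

theorem val_ne_bot (x : finiteBelow κ G w) : val x ≠ ⊥ := by
  by_cases hx : x = 0
  · simp [hx, val_zero]
  · obtain ⟨g, -, hg⟩ := exists_val_eq hx
    simp [hg]

theorem le_val_add {x y : finiteBelow κ G w} {s : EReal} (hx : s ≤ val x) (hy : s ≤ val y) :
    s ≤ val (x + y) := by
  refine le_val_iff.2 fun g hg => ?_
  by_cases h : x.1.coeff g = 0
  · refine le_val_iff.1 hy g fun h' => hg ?_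
    change x.1.coeff g + y.1.coeff g = 0
    rw [h, h', add_zero]
  · exact le_val_iff.1 hx g h

theorem le_val_neg {x : finiteBelow κ G w} {s : EReal} (hx : s ≤ val x) : s ≤ val (-x) := by
  refine le_val_iff.2 fun g hg => le_val_iff.1 hx g fun h => hg ?_
  change -x.1.coeff g = 0
  rw [h, neg_zero]

theorem le_val_mul {x y : finiteBelow κ G w} {s t : ℝ} (hx : (s : EReal) ≤ val x)
    (hy : (t : EReal) ≤ val y) : ((s + t : ℝ) : EReal) ≤ val (x * y) := by
  refine le_val_iff.2 fun g hg => ?_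
  obtain ⟨a, ha, b, hb, rfl⟩ := Set.mem_add.1 (HahnSeries.support_mul_subset hg)
  have h1 := le_val_iff.1 hx a ha
  have h2 := le_val_iff.1 hy b hb
  rw [EReal.coe_le_coe_iff] at *
  rw [map_add]
  exact add_le_add h1 h2

theorem zero_le_val_one : (0 : EReal) ≤ val (1 : finiteBelow κ G w) := by
  refine le_val_iff.2 fun g hg => ?_
  by_cases h : g = 0
  · simp [h]
  · exact absurd (HahnSeries.coeff_single_of_ne h) hg

theorem le_val_pow {x : finiteBelow κ G w} {s : ℝ} (hx : (s : EReal) ≤ val x) (n : ℕ) :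
    ((n * s : ℝ) : EReal) ≤ val (x ^ n) := by
  induction n with
  | zero => simpa using zero_le_val_one
  | succ n ih =>
    rw [pow_succ]
    convert le_val_mul ih hx using 2
    push_cast; ring

theorem eq_zero_of_forall_le_val {x : finiteBelow κ G w} {f : ℕ → ℝ}
    (hf : Filter.Tendsto f Filter.atTop Filter.atTop) (h : ∀ n, (f n : EReal) ≤ val x) :
    x = 0 := by
  by_contra hx
  obtain ⟨g, -, hg⟩ := exists_val_eq hx
  obtain ⟨n, hn⟩ := (hf.eventually (Filter.eventually_gt_atTop (w g))).exists
  have := h n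
  rw [hg, EReal.coe_le_coe_iff] at this
  exact absurd this (not_le.2 hn)

/-- The coefficient at `g` is constant over all indices `n` with `w g < f n`; the limit collects
these values. Its support is finite below every height, hence contains no infinite descending
sequence. -/
theorem exists_limit (hw : StrictMono w) (x : ℕ → finiteBelow κ G w) {f : ℕ → ℝ}
    (hf : Filter.Tendsto f Filter.atTop Filter.atTop)
    (h : ∀ m n, m ≤ n → (f m : EReal) ≤ val (x n - x m)) :
    ∃ y, ∀ n, (f n : EReal) ≤ val (y - x n) := by
  have key : ∀ m n g, w g < f m → w g < f n → (x m).1.coeff g = (x n).1.coeff g := by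
    have aux : ∀ m n g, m ≤ n → w g < f m → (x n).1.coeff g = (x m).1.coeff g := by
      intro m n g hmn hg
      by_contra hne
      have := le_val_iff.1 (h m n hmn) g (sub_ne_zero.2 hne)
      rw [EReal.coe_le_coe_iff] at this
      exact absurd this (not_le.2 hg)
    intro m n g hm hn
    rcases le_total m n with hmn | hmn
    · exact (aux m n g hmn hm).symm
    · exact aux n m g hmn hn
  have hN : ∀ C : ℝ, ∃ n, C < f n := fun C =>
    (hf.eventually (Filter.eventually_gt_atTop C)).exists
  choose N hN using hN
  set c : G → κ := fun g => (x (N (w g))).1.coeff g with hc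
  have hceq : ∀ n g, w g < f n → c g = (x n).1.coeff g := fun n g hg => key _ _ g (hN _) hg
  have hfin : ∀ C : ℝ, {g : G | c g ≠ 0 ∧ w g < C}.Finite := by
    intro C
    refine ((x (N C)).2 C).subset ?_
    rintro g ⟨hg, hgC⟩
    exact ⟨by rwa [← hceq (N C) g (hgC.trans (hN C))], hgC⟩
  have hpwo : (Function.support c).IsPWO := by
    rw [Set.isPWO_iff_isWF, Set.isWF_iff_no_descending_seq]
    intro u hu hmem
    refine Set.infinite_of_injective_forall_mem hu.injective (fun n => ?_)
      (hfin (w (u 0) + 1))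
    exact ⟨hmem n, (hw.monotone (hu.antitone (Nat.zero_le n))).trans_lt (lt_add_one _)⟩
  refine ⟨⟨⟨c, hpwo⟩, hfin⟩, fun n => le_val_iff.2 fun g hg => ?_⟩
  rw [EReal.coe_le_coe_iff]
  by_contra hlt
  exact hg (sub_eq_zero.2 (hceq n g (not_le.1 hlt)))

/-- Scaling the leading term to `1` writes the series as `1 - y` with `y` of positive valuation, and
the geometric series in `y` converges. -/
theorem exists_mul_eq_one (hw : StrictMono w) {x : finiteBelow κ G w} (hx : x ≠ 0) :
    ∃ y, x * y = 1 := by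
  obtain ⟨g, hg, hxg⟩ := exists_val_eq hx
  set u : finiteBelow κ G w :=
    ⟨HahnSeries.single (-g) (x.1.coeff g)⁻¹, single_mem_finiteBelow _ _ _⟩ with hu
  set y := 1 - u * x with hy
  -- `u * x` has constant term `1` and no exponent of negative height, so the least height in `y` is
  -- attained and positive.
  obtain ⟨δ, hδ, hyδ⟩ : ∃ δ : ℝ, 0 < δ ∧ (δ : EReal) ≤ val y := by
    by_cases hy0 : y = 0
    · exact ⟨1, one_pos, by rw [hy0, val_zero]; exact le_top⟩
    obtain ⟨h, hh, hyh⟩ := exists_val_eq hy0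
    refine ⟨w h, ?_, hyh.ge⟩
    have hcoe : y.1.coeff h =
        (1 : HahnSeries G κ).coeff h - (x.1.coeff g)⁻¹ * x.1.coeff (h - -g) := by
      rw [← HahnSeries.coeff_single_mul]; rfl
    have h0 : h ≠ 0 := by
      rintro rfl
      apply hh
      rw [hcoe, zero_sub, neg_neg, inv_mul_cancel₀ hg]
      simp
    have h1 : x.1.coeff (h - -g) ≠ 0 := by
      intro h1
      apply hh
      rw [hcoe, h1, mul_zero, sub_zero]
      exact HahnSeries.coeff_single_of_ne h0
    have h2 := val_le h1
    rw [hxg, EReal.coe_le_coe_iff, sub_neg_eq_add, map_add] at h2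
    have h3 : 0 ≤ w h := by linarith
    refine lt_of_le_of_ne h3 fun h4 => h0 (hw.injective ?_)
    rw [map_zero, ← h4]
  have hf : Filter.Tendsto (fun n : ℕ => (n : ℝ) * δ) Filter.atTop Filter.atTop :=
    tendsto_natCast_atTop_atTop.atTop_mul_const hδ
  obtain ⟨z, hz⟩ := exists_limit hw (fun n => ∑ i ∈ Finset.range n, y ^ i) hf (by
    intro m n hmn
    rw [← Finset.sum_Ico_eq_sub _ hmn]
    have : ∀ s : Finset ℕ, (∀ i ∈ s, m ≤ i) → ((m * δ : ℝ) : EReal) ≤ val (∑ i ∈ s, y ^ i) := by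
      intro s
      induction s using Finset.cons_induction with
      | empty => intro _; rw [Finset.sum_empty, val_zero]; exact le_top
      | cons a s ha ih =>
        intro hs
        rw [Finset.sum_cons]
        refine le_val_add (le_trans ?_ (le_val_pow hyδ a)) (ih fun i hi => hs i (by simp [hi]))
        rw [EReal.coe_le_coe_iff]
        have : (m : ℝ) ≤ a := by exact_mod_cast hs a (by simp)
        gcongr
    exact this _ fun i hi => (Finset.mem_Ico.1 hi).1)
  have h1 : (1 - y) * z = 1 := by
    refine sub_eq_zero.1 (eq_zero_of_forall_le_val hf fun n => ?_)
    have h2 : (1 - y) * z - 1 = (1 - y) * (z - ∑ i ∈ Finset.range n, y ^ i) + -(y ^ n) := by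
      rw [mul_sub, mul_neg_geom_sum]; ring
    rw [h2]
    refine le_val_add ?_ (le_val_neg (le_val_pow hyδ n))
    have h3 : ((0 : ℝ) : EReal) ≤ val (1 - y) := by
      rw [sub_eq_add_neg]
      exact le_val_add (by simpa using zero_le_val_one)
        (le_val_neg (le_trans (by exact_mod_cast hδ.le) hyδ))
    simpa using le_val_mul h3 (hz n)
  refine ⟨u * z, ?_⟩
  rw [← h1, hy]; ring

/-- The inequality is strict because the remainder attains its least height and `w` is injective. -/
theorem exists_leading_term (hw : StrictMono w) {x : finiteBelow κ G w} (hx : x ≠ 0) :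
    ∃ (g : G) (a : κ), a ≠ 0 ∧ val x = w g ∧
      ((w g : ℝ) : EReal) <
        val (x - ⟨HahnSeries.single g a, single_mem_finiteBelow _ _ _⟩) := by
  obtain ⟨g, hg, hxg⟩ := exists_val_eq hx
  refine ⟨g, x.1.coeff g, hg, hxg, ?_⟩
  set y := x - ⟨HahnSeries.single g (x.1.coeff g), single_mem_finiteBelow _ _ _⟩ with hy
  by_cases hy0 : y = 0
  · rw [hy0, val_zero]; exact EReal.coe_lt_top _
  obtain ⟨h, hh, hyh⟩ := exists_val_eq hy0
  have hcoe : y.1.coeff h = x.1.coeff h - (HahnSeries.single g (x.1.coeff g)).coeff h := rfl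
  have hne : h ≠ g := by
    rintro rfl
    exact hh (by rw [hcoe, HahnSeries.coeff_single_same, sub_self])
  rw [hcoe, HahnSeries.coeff_single_of_ne hne, sub_zero] at hh
  have h2 := val_le hh
  rw [hxg] at h2
  rw [hyh]
  exact lt_of_le_of_ne h2 fun h3 => hne (hw.injective (EReal.coe_injective h3)).symm

end FiniteBelow

/-! ### Novikov fields -/

/-- `v` makes `K` a Novikov completion of `κ[Γ]`, with the exponents ordered by `w`. -/
structure IsNovikov (κ : Type*) [Field κ] {Γ : AddSubgroup ℝ} (w : Γ →+ ℝ) {K : Type*}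
    [CommRing K] [Algebra (Lam κ Γ) K] (v : K → EReal) : Prop where
  eq_top_iff : ∀ x, v x = ⊤ ↔ x = 0
  ne_bot : ∀ x, v x ≠ ⊥
  exists_limit : ∀ (x : ℕ → K) (f : ℕ → ℝ), Filter.Tendsto f Filter.atTop Filter.atTop →
    (∀ m n, m ≤ n → (f m : EReal) ≤ v (x n - x m)) → ∃ y, ∀ n, (f n : EReal) ≤ v (y - x n)
  exists_leading : ∀ x, x ≠ 0 → ∃ (g : Γ) (a : κ), a ≠ 0 ∧ v x = w g ∧
    ((w g : ℝ) : EReal) <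
      v (x - algebraMap (Lam κ Γ) K (AddMonoidAlgebra.single g a))
  le_iff : ∀ (x : Lam κ Γ) (s : EReal),
    s ≤ v (algebraMap (Lam κ Γ) K x) ↔ ∀ g, x.coeff g ≠ 0 → s ≤ ((w g : ℝ) : EReal)
  isField : IsField K

variable {κ : Type*} [Field κ] {Γ : AddSubgroup ℝ}

theorem heightUp_strictMono : StrictMono (heightUp Γ) := fun _ _ h => h

theorem heightDown_strictMono : StrictMono (heightDown Γ) := fun a b h => by
  have : OrderDual.ofDual b < OrderDual.ofDual a := h
  exact neg_lt_neg this

theorem algebraMap_lamUp_single (g : Γ) (a : κ) :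
    algebraMap (Lam κ Γ) (LamUp κ Γ) (AddMonoidAlgebra.single g a) =
      (⟨HahnSeries.single g a, single_mem_finiteBelow _ _ _⟩ :
        finiteBelow κ Γ (heightUp Γ)) := by
  refine (AddMonoidAlgebra.lift_single _ _ _).trans (Subtype.ext ?_)
  change a • HahnSeries.single g (1 : κ) = HahnSeries.single g a
  ext h
  rw [HahnSeries.coeff_smul, HahnSeries.coeff_single, HahnSeries.coeff_single]
  split_ifs <;> simp

theorem algebraMap_lamDown_single (g : Γ) (a : κ) :
    algebraMap (Lam κ Γ) (LamDown κ Γ) (AddMonoidAlgebra.single g a) =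
      (⟨HahnSeries.single (OrderDual.toDual g) a, single_mem_finiteBelow _ _ _⟩ :
        finiteBelow κ (Γ)ᵒᵈ (heightDown Γ)) := by
  refine (AddMonoidAlgebra.lift_single _ _ _).trans (Subtype.ext ?_)
  change a • HahnSeries.single (OrderDual.toDual g) (1 : κ) = HahnSeries.single _ a
  ext h
  rw [HahnSeries.coeff_smul, HahnSeries.coeff_single, HahnSeries.coeff_single]
  split_ifs <;> simp

theorem LamUp.coeff_algebraMap (x : Lam κ Γ) (g : Γ) :
    (algebraMap (Lam κ Γ) (LamUp κ Γ) x).coeff g = x.coeff g := by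
  induction x using AddMonoidAlgebra.induction_linear with
  | zero => rw [map_zero]; rfl
  | add x y hx hy =>
    rw [map_add]
    exact congrArg₂ (· + ·) hx hy
  | single h a =>
    rw [algebraMap_lamUp_single]
    change (HahnSeries.single h a).coeff g = Finsupp.single h a g
    rw [HahnSeries.coeff_single, Finsupp.single_apply]
    split_ifs with h1 h2 h2
    exacts [rfl, absurd h1.symm h2, absurd h2.symm h1, rfl]

theorem LamDown.coeff_algebraMap (x : Lam κ Γ) (g : Γ) :
    (algebraMap (Lam κ Γ) (LamDown κ Γ) x).coeff g = x.coeff g := by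
  induction x using AddMonoidAlgebra.induction_linear with
  | zero => rw [map_zero]; rfl
  | add x y hx hy =>
    rw [map_add]
    exact congrArg₂ (· + ·) hx hy
  | single h a =>
    rw [algebraMap_lamDown_single]
    change (HahnSeries.single (OrderDual.toDual h) a).coeff (OrderDual.toDual g) =
      Finsupp.single h a g
    rw [HahnSeries.coeff_single, Finsupp.single_apply]
    simp only [eq_comm, OrderDual.toDual_inj]

theorem neg_nuDown_eq_val (x : LamDown κ Γ) :
    -nuDown x = val (κ := κ) (G := (Γ)ᵒᵈ) (w := heightDown Γ) x := by
  refine eq_of_forall_le_iff fun s => ?_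
  refine Iff.trans ?_ le_val_iff.symm
  rw [EReal.le_neg, nuDown, iSup₂_le_iff]
  refine forall₂_congr fun g _ => ?_
  rw [EReal.le_neg, ← EReal.coe_neg]
  rfl

theorem isNovikov_nuUp : IsNovikov κ (heightUp Γ) (nuUp (κ := κ) (Γ := Γ)) where
  eq_top_iff _ := val_eq_top_iff
  ne_bot := val_ne_bot
  exists_limit x _ hf h := exists_limit heightUp_strictMono x hf h
  exists_leading x hx := by
    obtain ⟨g, a, ha, h1, h2⟩ := exists_leading_term heightUp_strictMono hx
    refine ⟨g, a, ha, h1, ?_⟩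
    rw [algebraMap_lamUp_single]
    exact h2
  le_iff x s := by
    refine le_val_iff.trans (forall_congr' fun g => ?_)
    rw [← LamUp.coeff_algebraMap x g]
    rfl
  isField :=
    { exists_pair_ne := ⟨0, 1, fun h => by
        have := congrArg (fun x : LamUp κ Γ => x.1.coeff 0) h
        exact zero_ne_one (this.trans (HahnSeries.coeff_single_same _ _))⟩
      mul_comm := mul_comm
      mul_inv_cancel := fun hx => exists_mul_eq_one heightUp_strictMono hx }

theorem isNovikov_nuDown :
    IsNovikov κ (-heightUp Γ) (fun x : LamDown κ Γ => -nuDown x) where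
  eq_top_iff x := by rw [neg_nuDown_eq_val]; exact val_eq_top_iff
  ne_bot x := by rw [neg_nuDown_eq_val]; exact val_ne_bot _
  exists_limit x f hf h := by
    simp only [neg_nuDown_eq_val] at h ⊢
    exact exists_limit heightDown_strictMono x hf h
  exists_leading x hx := by
    obtain ⟨g, a, ha, h1, h2⟩ := exists_leading_term heightDown_strictMono hx
    refine ⟨OrderDual.ofDual g, a, ha, ?_, ?_⟩
    · rw [neg_nuDown_eq_val]; exact h1
    · rw [neg_nuDown_eq_val, algebraMap_lamDown_single]
      exact h2
  le_iff x s := by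
    rw [neg_nuDown_eq_val]
    refine le_val_iff.trans (forall_congr' fun g => ?_)
    rw [← LamDown.coeff_algebraMap x g]
    rfl
  isField :=
    { exists_pair_ne := ⟨0, 1, fun h => by
        have := congrArg (fun x : LamDown κ Γ => x.1.coeff 0) h
        exact zero_ne_one (this.trans (HahnSeries.coeff_single_same _ _))⟩
      mul_comm := mul_comm
      mul_inv_cancel := fun hx => exists_mul_eq_one heightDown_strictMono hx }

/-! ### Normed spaces over a Novikov field -/

/-- `ρ : V → ℝ ∪ {-∞}` is an ultrametric size function, compatible with the valuation `v` of
the scalars. -/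
structure IsSize {K : Type*} [CommRing K] (v : K → EReal) {V : Type*} [AddCommGroup V]
    [Module K V] (ρ : V → EReal) : Prop where
  ne_top : ∀ x, ρ x ≠ ⊤
  eq_bot_iff : ∀ x, ρ x = ⊥ ↔ x = 0
  smul : ∀ (c : K) (x : V), ρ (c • x) = ρ x - v c
  add_le : ∀ x y, ρ (x + y) ≤ max (ρ x) (ρ y)

theorem IsNormUp.isSize {V : Type*} [AddCommGroup V] [Module (LamUp κ Γ) V] {ρ : V → EReal}
    (h : IsNormUp (κ := κ) (Γ := Γ) ρ) : IsSize (nuUp (κ := κ) (Γ := Γ)) ρ :=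
  ⟨h.ne_top, h.eq_bot_iff, h.smul, h.add_le⟩

theorem IsNormDown.isSize {V : Type*} [AddCommGroup V] [Module (LamDown κ Γ) V] {ρ : V → EReal}
    (h : IsNormDown (κ := κ) (Γ := Γ) ρ) :
    IsSize (fun c : LamDown κ Γ => -nuDown c) (fun x => -ρ x) where
  ne_top x := by simpa using h.ne_bot x
  eq_bot_iff x := by simpa using h.eq_top_iff x
  smul c x := by
    by_cases hx : x = 0
    · have h0 : ρ 0 = ⊤ := (h.eq_top_iff 0).2 rfl
      rw [hx, smul_zero, h0, EReal.neg_top, EReal.bot_sub]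
    · have hx1 : ρ x ≠ ⊤ := fun hh => hx ((h.eq_top_iff x).1 hh)
      rw [h.smul, EReal.neg_sub (Or.inl (h.ne_bot x)) (Or.inl hx1), sub_eq_add_neg, neg_neg]
  add_le x y := by
    rw [EReal.max_neg_neg, EReal.neg_le_neg_iff]
    exact h.le_add x y

theorem eq_bot_of_forall_le {x : EReal} {f : ℕ → ℝ}
    (hf : Filter.Tendsto f Filter.atTop Filter.atBot) (h : ∀ n, x ≤ f n) : x = ⊥ := by
  refine EReal.eq_bot_iff_forall_lt x |>.2 fun y => ?_
  obtain ⟨n, hn⟩ := (hf.eventually (Filter.eventually_lt_atBot y)).exists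
  exact (h n).trans_lt (EReal.coe_lt_coe_iff.2 hn)

namespace IsNovikov

variable {w : Γ →+ ℝ} {K : Type*} [CommRing K] [Algebra (Lam κ Γ) K] {v : K → EReal}

theorem map_single (hv : IsNovikov κ w v) (g : Γ) {a : κ} (ha : a ≠ 0) :
    v (algebraMap (Lam κ Γ) K (AddMonoidAlgebra.single g a)) = w g := by
  refine eq_of_forall_le_iff fun s => ?_
  rw [hv.le_iff]
  constructor
  · intro h
    refine h g ?_
    change Finsupp.single g a g ≠ 0
    rwa [Finsupp.single_eq_same]
  · intro h g' hg'
    change Finsupp.single g a g' ≠ 0 at hg'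
    rwa [(Finsupp.single_apply_ne_zero.1 hg').1]

theorem map_neg_one (hv : IsNovikov κ w v) : v (-1) = 0 := by
  have h := hv.map_single 0 (neg_ne_zero.2 (one_ne_zero (α := κ)))
  rw [map_zero, EReal.coe_zero] at h
  rw [← h]
  congr 1
  rw [AddMonoidAlgebra.single_neg, map_neg, ← AddMonoidAlgebra.one_def, map_one]

theorem coe_toReal (hv : IsNovikov κ w v) {c : K} (hc : c ≠ 0) : ((v c).toReal : EReal) = v c :=
  EReal.coe_toReal (fun h => hc ((hv.eq_top_iff c).1 h)) (hv.ne_bot c)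

theorem map_zero' (hv : IsNovikov κ w v) : v 0 = ⊤ := (hv.eq_top_iff 0).2 rfl

end IsNovikov

namespace IsSize

variable {w : Γ →+ ℝ} {K : Type*} [CommRing K] [Algebra (Lam κ Γ) K] {v : K → EReal}
  {V : Type*} [AddCommGroup V] [Module K V] {ρ : V → EReal}

theorem map_zero (h : IsSize v ρ) : ρ 0 = ⊥ := (h.eq_bot_iff 0).2 rfl

theorem coe_toReal (h : IsSize v ρ) {x : V} (hx : x ≠ 0) : ((ρ x).toReal : EReal) = ρ x :=
  EReal.coe_toReal (h.ne_top x) fun hh => hx ((h.eq_bot_iff x).1 hh)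

theorem map_neg (h : IsSize v ρ) (hv : IsNovikov κ w v) (x : V) : ρ (-x) = ρ x := by
  rw [← neg_one_smul K x, h.smul, hv.map_neg_one, sub_zero]

theorem sub_le (h : IsSize v ρ) (hv : IsNovikov κ w v) (x y : V) :
    ρ (x - y) ≤ max (ρ x) (ρ y) := by
  rw [sub_eq_add_neg, ← h.map_neg hv y]
  exact h.add_le _ _

theorem sum_le (h : IsSize v ρ) {ι : Type*} (s : Finset ι) (f : ι → V) {B : EReal}
    (hf : ∀ i ∈ s, ρ (f i) ≤ B) : ρ (∑ i ∈ s, f i) ≤ B := by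
  induction s using Finset.cons_induction with
  | empty => rw [Finset.sum_empty, h.map_zero]; exact bot_le
  | cons a s ha ih =>
    rw [Finset.sum_cons]
    exact (h.add_le _ _).trans
      (max_le (hf a (by simp)) (ih fun i hi => hf i (by simp [hi])))

theorem sum_lt (h : IsSize v ρ) {ι : Type*} (s : Finset ι) (f : ι → V) {B : EReal}
    (hB : ⊥ < B) (hf : ∀ i ∈ s, ρ (f i) < B) : ρ (∑ i ∈ s, f i) < B := by
  induction s using Finset.cons_induction with
  | empty => rwa [Finset.sum_empty, h.map_zero]
  | cons a s ha ih =>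
    rw [Finset.sum_cons]
    exact (h.add_le _ _).trans_lt
      (max_lt (hf a (by simp)) (ih fun i hi => hf i (by simp [hi])))

theorem add_eq_right (h : IsSize v ρ) (hv : IsNovikov κ w v) {x y : V} (hxy : ρ x < ρ y) :
    ρ (x + y) = ρ y := by
  refine le_antisymm ((h.add_le x y).trans (max_le hxy.le le_rfl)) ?_
  by_contra! hlt
  have h1 := h.sub_le hv (x + y) x
  rw [add_sub_cancel_left] at h1
  exact absurd h1 (not_le.2 (max_lt hlt hxy))

theorem smul_le (h : IsSize v ρ) {c : K} {x : V} {r s : ℝ} (hc : (s : EReal) ≤ v c)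
    (hx : ρ x ≤ r) : ρ (c • x) ≤ ((r - s : ℝ) : EReal) := by
  rw [h.smul, EReal.coe_sub]
  exact EReal.sub_le_sub hx hc

end IsSize

/-- A linear functional on a finite-dimensional normed space over a complete valued field is
bounded. -/
theorem IsSize.exists_bound {w : Γ →+ ℝ} {K : Type*} [Field K] [Algebra (Lam κ Γ) K]
    {v : K → EReal} (hv : IsNovikov κ w v) {V : Type*} [AddCommGroup V] [Module K V]
    [Module.Finite K V] {ρ : V → EReal} (h : IsSize v ρ) (l : V →ₗ[K] K) :
    ∃ C : ℝ, ∀ (x : V) (s : ℝ), ρ x ≤ s → ((-s - C : ℝ) : EReal) ≤ v (l x) := by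
  induction hn : Module.finrank K V using Nat.strong_induction_on generalizing V with
  | _ n ih =>
  by_contra! hcon
  -- Some `x` violates the bound with constant `n`; dividing it by `l x` gives `u`.
  have hu : ∀ n : ℕ, ∃ u : V, l u = 1 ∧ ρ u ≤ ((-n : ℝ) : EReal) := by
    intro n
    obtain ⟨x, s, hxs, hlt⟩ := hcon n
    have hlx : l x ≠ 0 := by
      intro h0
      rw [h0, hv.map_zero'] at hlt
      exact not_top_lt hlt
    refine ⟨(l x)⁻¹ • x, by rw [map_smul, smul_eq_mul, inv_mul_cancel₀ hlx], ?_⟩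
    have hx0 : (l x)⁻¹ • x ≠ 0 := by
      intro h0
      rcases smul_eq_zero.1 h0 with h1 | h1
      · exact hlx (inv_eq_zero.1 h1)
      · exact hlx (by rw [h1, _root_.map_zero])
    have h1 : ρ x = ρ ((l x)⁻¹ • x) - v (l x) := by
      rw [← h.smul, smul_inv_smul₀ hlx]
    rw [← h.coe_toReal hx0, ← hv.coe_toReal hlx, ← EReal.coe_sub] at h1
    rw [h1, EReal.coe_le_coe_iff] at hxs
    rw [← hv.coe_toReal hlx, EReal.coe_lt_coe_iff] at hlt
    rw [← h.coe_toReal hx0, EReal.coe_le_coe_iff]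
    linarith
  choose u hu1 hun using hu
  set W := LinearMap.ker l with hW
  have hW' : W ≠ ⊤ := by
    intro htop
    have : u 0 ∈ W := htop ▸ Submodule.mem_top
    exact one_ne_zero ((hu1 0).symm.trans this)
  have hsub : IsSize v (fun x : W => ρ x) :=
    ⟨fun x => h.ne_top x, fun x => (h.eq_bot_iff x).trans (by simp), fun c x => h.smul c x,
      fun x y => h.add_le x y⟩
  set b := Module.finBasis K W with hb
  -- The coordinates on `ker l` are bounded by induction, so a Cauchy sequence there converges
  -- coordinatewise.
  choose C hC using fun j => ih _ (hn ▸ Submodule.finrank_lt hW') hsub (b.coord j) rfl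
  have hz : ∀ n, u n - u 0 ∈ W := fun n => by
    rw [hW, LinearMap.mem_ker, map_sub, hu1, hu1, sub_self]
  set z : ℕ → W := fun n => ⟨u n - u 0, hz n⟩ with hzdef
  have hzz : ∀ m n, m ≤ n → ρ (z n - z m : W) ≤ ((-m : ℝ) : EReal) := by
    intro m n hmn
    have : ((z n - z m : W) : V) = u n - u m := by simp [hzdef]
    rw [this]
    refine (h.sub_le hv _ _).trans (max_le ((hun n).trans ?_) (hun m))
    rw [EReal.coe_le_coe_iff]
    have : (m : ℝ) ≤ n := by exact_mod_cast hmn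
    linarith
  have hlim : ∀ j, ∃ y, ∀ n : ℕ, ((n - C j : ℝ) : EReal) ≤ v (y - b.coord j (z n)) := by
    intro j
    refine hv.exists_limit (fun n => b.coord j (z n)) (fun n => n - C j)
      (Filter.tendsto_atTop_add_const_right _ _ tendsto_natCast_atTop_atTop) ?_
    intro m n hmn
    have := hC j (z n - z m) (-m) (hzz m n hmn)
    rwa [neg_neg, map_sub] at this
  choose y hy using hlim
  -- `U` is the limit of the `u n`. Its size is at most a constant minus `n` for every `n`, so `U =
  -- 0`, although `l U = 1`.
  set U : V := u 0 + ((∑ j, y j • b j : W) : V) with hU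
  have hdiff : ∀ n, U = u n + ∑ j, (y j - b.coord j (z n)) • (b j : V) := by
    intro n
    have h1 : (z n : V) = ∑ j, b.coord j (z n) • (b j : V) := by
      conv_lhs => rw [← b.sum_repr (z n)]
      push_cast
      rfl
    have h2 : u n = u 0 + (z n : V) := by simp [hzdef]
    simp only [sub_smul, Finset.sum_sub_distrib]
    rw [← h1, hU, h2]
    push_cast
    abel
  have hb0 : ∀ j, (b j : V) ≠ 0 := fun j h0 => b.ne_zero j (Subtype.ext h0)
  obtain ⟨D, hD⟩ : ∃ D : ℝ, ∀ j, (ρ (b j : V)).toReal + C j ≤ D := by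
    obtain ⟨D, hD⟩ := (Set.finite_range fun j => (ρ (b j : V)).toReal + C j).bddAbove
    exact ⟨D, fun j => hD ⟨j, rfl⟩⟩
  have hUle : ∀ n : ℕ, ρ U ≤ ((max D 0 + -(n : ℝ) : ℝ) : EReal) := by
    intro n
    rw [hdiff n]
    refine (h.add_le _ _).trans (max_le ((hun n).trans ?_) (h.sum_le _ _ fun j _ => ?_))
    · rw [EReal.coe_le_coe_iff]
      linarith [le_max_right D 0]
    · refine (h.smul_le (hy j n) (h.coe_toReal (hb0 j)).ge).trans ?_
      rw [EReal.coe_le_coe_iff]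
      linarith [le_max_left D 0, hD j]
  have hU0 : U = 0 := (h.eq_bot_iff U).1 (eq_bot_of_forall_le
    (Filter.tendsto_atBot_add_const_left _ _
      (Filter.tendsto_neg_atTop_atBot.comp tendsto_natCast_atTop_atTop)) hUle)
  have hU1 : l U = 1 := by
    rw [hU, map_add, hu1]
    have : l ((∑ j, y j • b j : W) : V) = 0 := (∑ j, y j • b j : W).2
    rw [this, add_zero]
  rw [hU0, _root_.map_zero] at hU1
  exact zero_ne_one hU1

theorem IsNovikov.exists_bound {κ : Type*} [Field κ] {Γ : AddSubgroup ℝ}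
    {w : Γ →+ ℝ} {K : Type*} [CommRing K] [Algebra (Lam κ Γ) K]
    {v : K → EReal} (hv : IsNovikov κ w v) {V : Type*} [AddCommGroup V] [Module K V]
    [Module.Finite K V] {ρ : V → EReal} (h : IsSize v ρ) (l : V →ₗ[K] K) :
    ∃ C : ℝ, ∀ (x : V) (s : ℝ), ρ x ≤ s → ((-s - C : ℝ) : EReal) ≤ v (l x) := by
  let := hv.isField.toField
  exact h.exists_bound hv l

/-! ### Functionals on finitely generated modules over a domain -/

section Domain

variable {R : Type*} [CommRing R] {H : Type*} [AddCommGroup H] [Module R H]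

theorem one_tmul_eq_zero_iff (x : H) :
    (1 : FractionRing R) ⊗ₜ[R] x = 0 ↔ x ∈ Submodule.torsion R H := by
  rw [Submodule.mem_torsion_iff]
  exact IsLocalizedModule.eq_zero_iff (nonZeroDivisors R)
    (TensorProduct.mk R (FractionRing R) H 1)

/-- The coordinates on `Q ⊗ H`, restricted to `H`, become `R`-valued after multiplication by one
common denominator of their values on a finite generating set. -/
theorem exists_separating_functionals [IsDomain R] [Module.Finite R H] :
    ∃ (n : ℕ) (f : Fin n → H →ₗ[R] R),
      ∀ x, x ∉ Submodule.torsion R H → ∃ i, f i x ≠ 0 := by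
  classical
  set Q := FractionRing R
  set b := Module.finBasis Q (Q ⊗[R] H)
  set c : Fin (Module.finrank Q (Q ⊗[R] H)) → H →ₗ[R] Q := fun i =>
    (b.coord i).restrictScalars R ∘ₗ TensorProduct.mk R Q H 1 with hc
  obtain ⟨S, hS⟩ := Module.Finite.fg_top (R := R) (M := H)
  obtain ⟨s, hs⟩ := IsLocalization.exist_integer_multiples_of_finset (nonZeroDivisors R)
    ((Finset.univ ×ˢ S).image fun p => c p.1 p.2)
  have hs0 : (s : R) ≠ 0 := nonZeroDivisors.ne_zero s.2
  have hmem : ∀ i x, ((s : R) • c i) x ∈ LinearMap.range (Algebra.linearMap R Q) := by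
    intro i x
    have hx : x ∈ Submodule.span R (S : Set H) := hS ▸ Submodule.mem_top
    have hle : Submodule.span R (S : Set H) ≤
        (LinearMap.range (Algebra.linearMap R Q)).comap ((s : R) • c i) := by
      rw [Submodule.span_le]
      intro y hy
      obtain ⟨r, hr⟩ := hs (c i y) (Finset.mem_image.2 ⟨(i, y), by simpa using hy, rfl⟩)
      exact ⟨r, hr⟩
    exact hle hx
  choose f hf using hmem
  have hinj : Function.Injective (Algebra.linearMap R Q) := IsFractionRing.injective R Q
  refine ⟨_, fun i =>
    { toFun := f i
      map_add' := fun x y => hinj (by rw [map_add, hf, hf, hf, map_add])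
      map_smul' := fun r x => hinj (by
        rw [map_smul, hf, hf, map_smul]; rfl) }, fun x hx => ?_⟩
  by_contra! h0
  apply hx
  rw [← one_tmul_eq_zero_iff]
  refine b.ext_elem fun i => ?_
  have h1 := hf i x
  have h2 : f i x = 0 := h0 i
  rw [h2, map_zero, LinearMap.smul_apply] at h1
  rw [map_zero]
  exact (smul_eq_zero.1 h1.symm).resolve_left hs0

theorem finrank_quotient_torsion :
    Module.finrank R (H ⧸ Submodule.torsion R H) =
      Module.finrank (FractionRing R) (FractionRing R ⊗[R] H) := by
  have h1 : Module.finrank R (H ⧸ Submodule.torsion R H) = Module.finrank R H :=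
    congrArg Cardinal.toNat (rank_quotient_eq_of_le_torsion le_rfl)
  have h2 : Module.finrank R (FractionRing R ⊗[R] H) = Module.finrank R H :=
    IsLocalizedModule.finrank_eq (nonZeroDivisors R)
      (TensorProduct.mk R (FractionRing R) H 1) le_rfl
  have h3 : Module.finrank (FractionRing R) (FractionRing R ⊗[R] H) =
      Module.finrank R (FractionRing R ⊗[R] H) :=
    congrArg Cardinal.toNat (IsLocalization.rank_eq (FractionRing R) (nonZeroDivisors R) le_rfl)
  rw [h1, h3, h2]

end Domain

variable {H : Type*} [AddCommGroup H]
  [Module (Lam κ Γ) H]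

theorem Independent.notMem_torsion {k : ℕ} {x : Fin k → H} (h : Independent κ Γ x) (j : Fin k) :
    x j ∉ Submodule.torsion (Lam κ Γ) H := by
  rw [← one_tmul_eq_zero_iff]
  exact LinearIndependent.ne_zero j h

theorem exists_independent [Module.Finite (Lam κ Γ) H] {k : ℕ} (hk : k ≤ rank κ Γ H) :
    ∃ x : Fin k → H, Independent κ Γ x := by
  set Q := FractionRing (Lam κ Γ)
  set s : Set (Q ⊗[Lam κ Γ] H) := Set.range fun x : H => (1 : Q) ⊗ₜ[Lam κ Γ] x
  have hs : Submodule.span Q s = ⊤ := by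
    refine top_unique fun z _ => ?_
    induction z using TensorProduct.induction_on with
    | zero => exact zero_mem _
    | tmul q x =>
      have : q ⊗ₜ[Lam κ Γ] x = q • ((1 : Q) ⊗ₜ[Lam κ Γ] x) := by
        rw [TensorProduct.smul_tmul', smul_eq_mul, mul_one]
      rw [this]
      exact Submodule.smul_mem _ _ (Submodule.subset_span ⟨x, rfl⟩)
    | add a b ha hb => exact add_mem (ha trivial) (hb trivial)
  obtain ⟨f, hf, -, hli⟩ := Submodule.exists_fun_fin_finrank_span_eq Q s
  have hk' : k ≤ Module.finrank Q (Submodule.span Q s) := by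
    rw [hs, finrank_top]; exact hk
  choose x hx using hf
  refine ⟨fun j => x (Fin.castLE hk' j), ?_⟩
  have h2 := hli.comp _ (Fin.castLE_injective hk')
  rw [Independent, show (fun j => (1 : Q) ⊗ₜ[Lam κ Γ] x (Fin.castLE hk' j)) =
    f ∘ Fin.castLE hk' from funext fun j => hx _]
  exact h2

/-! ### Comparison of the two sizes on `H` -/

section BaseChange

variable {w : Γ →+ ℝ} {K : Type*} [CommRing K] [Algebra (Lam κ Γ) K] {v : K → EReal}
  {V : Type*} [AddCommGroup V] [Module K V] {ρ : V → EReal}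

theorem IsNovikov.algebraMap_eq_zero (hv : IsNovikov κ w v) {x : Lam κ Γ}
    (hx : algebraMap (Lam κ Γ) K x = 0) : x = 0 := by
  have h := (hv.le_iff x ⊤).1 ((hv.eq_top_iff _).2 hx).ge
  by_contra hne
  obtain ⟨g, hg⟩ : ∃ g, x.coeff g ≠ 0 := by
    by_contra! h0
    exact hne (AddMonoidAlgebra.ext (Finsupp.ext h0))
  exact absurd (h g hg) (not_le.2 (EReal.coe_lt_top _))

theorem IsSize.eq_zero_of_smul_eq_zero (hv : IsNovikov κ w v) (h : IsSize v ρ) {c : K} {x : V}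
    (hc : c ≠ 0) (hx : c • x = 0) : x = 0 := by
  by_contra hne
  have h1 := h.smul c x
  rw [hx, h.map_zero, ← h.coe_toReal hne, ← hv.coe_toReal hc, ← EReal.coe_sub] at h1
  exact EReal.coe_ne_bot _ h1.symm

variable [Module (Lam κ Γ) V] [IsScalarTower (Lam κ Γ) K V] {φ : H →ₗ[Lam κ Γ] V}

theorem IsSize.map_eq_zero_of_mem_torsion (hv : IsNovikov κ w v) (h : IsSize v ρ) {x : H}
    (hx : x ∈ Submodule.torsion (Lam κ Γ) H) : φ x = 0 := by
  obtain ⟨a, ha⟩ := (Submodule.mem_torsion_iff x).1 hx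
  refine h.eq_zero_of_smul_eq_zero hv (c := algebraMap (Lam κ Γ) K a)
    (fun h0 => nonZeroDivisors.ne_zero a.2 (hv.algebraMap_eq_zero h0)) ?_
  rw [algebraMap_smul, ← map_smul]
  exact (congrArg φ ha).trans (_root_.map_zero φ)

/-- A functional `H → Λ` that is nonzero at `x` extends to `V` by base change and so detects `φ x`.
-/
theorem IsNovikov.map_ne_zero [Module.Finite (Lam κ Γ) H] (hv : IsNovikov κ w v)
    (hφ : IsBaseChange K φ) {x : H} (hx : x ∉ Submodule.torsion (Lam κ Γ) H) : φ x ≠ 0 := by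
  intro h0
  obtain ⟨n, f, hf⟩ := exists_separating_functionals (R := Lam κ Γ) (H := H)
  obtain ⟨i, hi⟩ := hf x hx
  have h1 := hφ.lift_eq (Algebra.linearMap (Lam κ Γ) K ∘ₗ f i) x
  rw [h0, map_zero] at h1
  exact hi (hv.algebraMap_eq_zero h1.symm)

/-- One exponent `g` of a separating value `f i x` enters both functional bounds, with heights `w g`
and `-w g`, and cancels in the sum. -/
theorem exists_size_bound [Module.Finite (Lam κ Γ) H] [Module.Finite K V]
    (hv : IsNovikov κ w v) (hφ : IsBaseChange K φ) (hρ : IsSize v ρ)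
    {K' : Type*} [CommRing K'] [Algebra (Lam κ Γ) K'] {v' : K' → EReal}
    {V' : Type*} [AddCommGroup V'] [Module (Lam κ Γ) V'] [Module K' V']
    [IsScalarTower (Lam κ Γ) K' V'] [Module.Finite K' V'] {ρ' : V' → EReal}
    {φ' : H →ₗ[Lam κ Γ] V'}
    (hv' : IsNovikov κ (-w) v') (hφ' : IsBaseChange K' φ') (hρ' : IsSize v' ρ') :
    ∃ C : ℝ, ∀ x : H, x ∉ Submodule.torsion (Lam κ Γ) H →
      C ≤ (ρ (φ x)).toReal + (ρ' (φ' x)).toReal := by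
  obtain ⟨n, f, hf⟩ := exists_separating_functionals (R := Lam κ Γ) (H := H)
  choose C hC using fun i =>
    hv.exists_bound hρ (hφ.lift (Algebra.linearMap (Lam κ Γ) K ∘ₗ f i))
  choose C' hC' using fun i =>
    hv'.exists_bound hρ' (hφ'.lift (Algebra.linearMap (Lam κ Γ) K' ∘ₗ f i))
  obtain ⟨D, hD⟩ := (Set.finite_range fun i => -C i - C' i).bddBelow
  refine ⟨D, fun x hx => ?_⟩
  obtain ⟨i, hi⟩ := hf x hx
  have h1 := hC i (φ x) _ (hρ.coe_toReal (hv.map_ne_zero hφ hx)).ge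
  have h2 := hC' i (φ' x) _ (hρ'.coe_toReal (hv'.map_ne_zero hφ' hx)).ge
  rw [hφ.lift_eq] at h1
  rw [hφ'.lift_eq] at h2
  obtain ⟨g, hg⟩ : ∃ g, (f i x).coeff g ≠ 0 := by
    by_contra! h0
    exact hi (AddMonoidAlgebra.ext (Finsupp.ext h0))
  have h3 := EReal.coe_le_coe_iff.1 ((hv.le_iff _ _).1 h1 g hg)
  have h4 := EReal.coe_le_coe_iff.1 ((hv'.le_iff _ _).1 h2 g hg)
  have h5 : D ≤ -C i - C' i := hD ⟨i, rfl⟩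
  rw [AddMonoidHom.neg_apply] at h4
  linarith

end BaseChange

end FMP

/-! ### Finiteness and stability of the gaps -/

namespace FilteredMatchedPair

open FMP

variable {κ : Type*} [Field κ] {Γ : AddSubgroup ℝ} {H Vup Vdown : Type*}
    [AddCommGroup H] [Module (Lam κ Γ) H] [Module.Finite (Lam κ Γ) H]
    [AddCommGroup Vup] [Module (Lam κ Γ) Vup] [Module (LamUp κ Γ) Vup]
    [IsScalarTower (Lam κ Γ) (LamUp κ Γ) Vup] [Module.Finite (LamUp κ Γ) Vup]
    [AddCommGroup Vdown] [Module (Lam κ Γ) Vdown] [Module (LamDown κ Γ) Vdown]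
    [IsScalarTower (Lam κ Γ) (LamDown κ Γ) Vdown] [Module.Finite (LamDown κ Γ) Vdown]
    (P : FilteredMatchedPair κ Γ H Vup Vdown)

theorem phiUp_ne_zero {x : H} (hx : x ∉ Submodule.torsion (Lam κ Γ) H) : P.phiUp x ≠ 0 :=
  isNovikov_nuUp.map_ne_zero P.isBaseChange_up hx

theorem phiDown_ne_zero {x : H} (hx : x ∉ Submodule.torsion (Lam κ Γ) H) : P.phiDown x ≠ 0 :=
  isNovikov_nuDown.map_ne_zero P.isBaseChange_down hx

theorem coe_toReal_rhoUp {v : Vup} (hv : v ≠ 0) : ((P.rhoUp v).toReal : EReal) = P.rhoUp v :=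
  P.isNormUp.isSize.coe_toReal hv

theorem coe_toReal_rhoDown {v : Vdown} (hv : v ≠ 0) :
    ((P.rhoDown v).toReal : EReal) = P.rhoDown v :=
  EReal.coe_toReal (fun h => hv ((P.isNormDown.eq_top_iff v).1 h)) (P.isNormDown.ne_bot v)

theorem mem_gapSet_iff {i : ℕ} {γ : ℝ} : γ ∈ P.gapSet i ↔
    ∃ x : Fin i → H, Independent κ Γ x ∧
      ∀ j, γ ≤ (P.rhoDown (P.phiDown (x j))).toReal - (P.rhoUp (P.phiUp (x j))).toReal := by
  refine exists_congr fun x => and_congr_right fun hx => forall_congr' fun j => ?_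
  rw [← P.coe_toReal_rhoUp (P.phiUp_ne_zero (hx.notMem_torsion j)),
    ← P.coe_toReal_rhoDown (P.phiDown_ne_zero (hx.notMem_torsion j)), ← EReal.coe_sub,
    EReal.coe_le_coe_iff, EReal.toReal_coe, EReal.toReal_coe]

theorem isLUB_gap {i : ℕ} (h1 : 1 ≤ i) (hi : i ≤ rank κ Γ H) :
    IsLUB (P.gapSet i) (P.gap i) := by
  refine isLUB_csSup ?_ ?_
  · obtain ⟨x, hx⟩ := exists_independent hi
    obtain ⟨m, hm⟩ := (Set.finite_range fun j =>
      (P.rhoDown (P.phiDown (x j))).toReal - (P.rhoUp (P.phiUp (x j))).toReal).bddBelow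
    exact ⟨m, P.mem_gapSet_iff.2 ⟨x, hx, fun j => hm ⟨j, rfl⟩⟩⟩
  · obtain ⟨C, hC⟩ := exists_size_bound isNovikov_nuUp P.isBaseChange_up P.isNormUp.isSize
      isNovikov_nuDown P.isBaseChange_down P.isNormDown.isSize
    refine ⟨-C, fun γ hγ => ?_⟩
    obtain ⟨x, hx, hxγ⟩ := P.mem_gapSet_iff.1 hγ
    -- A single member of the family bounds `γ`; one exists because `1 ≤ i`.
    have h2 := hC _ (hx.notMem_torsion ⟨0, h1⟩)
    have h3 := hxγ ⟨0, h1⟩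
    rw [EReal.toReal_neg_eq] at h2
    linarith

variable {P} {Q : FilteredMatchedPair κ Γ H Vup Vdown} {t : ℝ}

theorem gap_le_add (hphiUp : Q.phiUp = P.phiUp) (hphiDown : Q.phiDown = P.phiDown)
    (hUp : ∀ x : Vup, x ≠ 0 → |(P.rhoUp x).toReal - (Q.rhoUp x).toReal| ≤ t)
    (hDown : ∀ x : Vdown, x ≠ 0 → |(P.rhoDown x).toReal - (Q.rhoDown x).toReal| ≤ t)
    {i : ℕ} (h1 : 1 ≤ i) (hi : i ≤ rank κ Γ H) : P.gap i ≤ Q.gap i + 2 * t := by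
  refine (P.isLUB_gap h1 hi).2 fun γ hγ => ?_
  obtain ⟨x, hx, hxγ⟩ := P.mem_gapSet_iff.1 hγ
  have : γ - 2 * t ∈ Q.gapSet i := by
    refine Q.mem_gapSet_iff.2 ⟨x, hx, fun j => ?_⟩
    have h2 := abs_le.1 (hUp _ (P.phiUp_ne_zero (hx.notMem_torsion j)))
    have h3 := abs_le.1 (hDown _ (P.phiDown_ne_zero (hx.notMem_torsion j)))
    rw [hphiUp, hphiDown]
    linarith [hxγ j]
  linarith [(Q.isLUB_gap h1 hi).1 this]

theorem abs_gap_sub_le (hphiUp : Q.phiUp = P.phiUp) (hphiDown : Q.phiDown = P.phiDown)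
    (hUp : ∀ x : Vup, x ≠ 0 → |(P.rhoUp x).toReal - (Q.rhoUp x).toReal| ≤ t)
    (hDown : ∀ x : Vdown, x ≠ 0 → |(P.rhoDown x).toReal - (Q.rhoDown x).toReal| ≤ t)
    {i : ℕ} (h1 : 1 ≤ i) (hi : i ≤ rank κ Γ H) : |P.gap i - Q.gap i| ≤ 2 * t := by
  have h2 := gap_le_add hphiUp hphiDown hUp hDown h1 hi
  have h3 := gap_le_add hphiUp.symm hphiDown.symm (fun x hx => by rw [abs_sub_comm]; exact hUp x hx)
    (fun x hx => by rw [abs_sub_comm]; exact hDown x hx) h1 hi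
  rw [abs_le]
  constructor <;> linarith

end FilteredMatchedPair

/-! ### A matching criterion for inverse matrices -/

namespace FMP

/-- A Hall-type matching criterion: if `B * A = 1` and every index `j` contributing to an entry of
the product with `wt i ≤ wt i'` is a neighbour of `i` or of `i'`, then there is a perfect
matching. -/
theorem exists_perm_forall_mem {R : Type*} [CommRing R] [Nontrivial R] {ι : Type*} [Fintype ι]
    [DecidableEq ι] {A B : Matrix ι ι R} (hBA : B * A = 1) (N : ι → Finset ι) (wt : ι → ℝ)
    (h : ∀ i i' j, wt i ≤ wt i' → A j i ≠ 0 → B i' j ≠ 0 → j ∈ N i ∨ j ∈ N i') :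
    ∃ σ : Equiv.Perm ι, ∀ i, σ i ∈ N i := by
  classical
  obtain ⟨f, hf, hfN⟩ := (Finset.all_card_le_biUnion_card_iff_exists_injective N).1 (by
    intro S
    set T := S.biUnion N
    -- Hall's inequality for `S` follows once the block of `A` with rows `T` and columns `S` is
    -- injective.
    set L := (A.submatrix (fun j : T => (j : ι)) (fun i : S => (i : ι))).mulVecLin with hL
    suffices hinj : Function.Injective L by
      simpa using card_le_of_injective R L hinj
    rw [← LinearMap.ker_eq_bot, LinearMap.ker_eq_bot']
    intro c hc
    by_contra hne
    obtain ⟨i₁, hi₁⟩ := Function.ne_iff.1 hne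
    obtain ⟨i₀, hi₀, hmax⟩ := Finset.exists_max_image (Finset.univ.filter fun i : S => c i ≠ 0)
      (fun i => wt i) ⟨i₁, by simpa using hi₁⟩
    have hi₀' : c i₀ ≠ 0 := by simpa using hi₀
    apply hi₀'
    have hrow : ∀ j ∈ T, ∑ i : S, A j i * c i = 0 := fun j hj => congrFun hc ⟨j, hj⟩
    -- As `i₀` has the largest weight in the support of `c`, every nonzero term of the product has
    -- its index `j` in `T`. Row `i₀` of `B` restricted to `T` therefore recovers `c i₀` from `A c`.
    have hentry : ∀ i : S, c i ≠ 0 →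
        ∑ j ∈ T, B i₀ j * A j i = (1 : Matrix ι ι R) i₀ i := by
      intro i hi
      rw [← hBA, Matrix.mul_apply]
      refine Finset.sum_subset (Finset.subset_univ _) fun j _ hj => ?_
      by_contra hprod
      rcases h i i₀ j (hmax i (by simpa using hi)) (right_ne_zero_of_mul hprod)
        (left_ne_zero_of_mul hprod) with h1 | h1
      · exact hj (Finset.mem_biUnion.2 ⟨i, i.2, h1⟩)
      · exact hj (Finset.mem_biUnion.2 ⟨i₀, i₀.2, h1⟩)
    calc c i₀ = ∑ i : S, (1 : Matrix ι ι R) i₀ i * c i := by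
          rw [Finset.sum_eq_single i₀]
          · rw [Matrix.one_apply_eq, one_mul]
          · intro i _ hi
            rw [Matrix.one_apply_ne fun hh => hi (Subtype.ext hh.symm), zero_mul]
          · simp
      _ = ∑ i : S, (∑ j ∈ T, B i₀ j * A j i) * c i := by
          refine Finset.sum_congr rfl fun i _ => ?_
          by_cases hi : c i = 0
          · rw [hi, mul_zero, mul_zero]
          · rw [hentry i hi]
      _ = ∑ j ∈ T, B i₀ j * ∑ i : S, A j i * c i := by
          simp only [Finset.sum_mul, Finset.mul_sum, mul_assoc]
          exact Finset.sum_comm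
      _ = 0 := Finset.sum_eq_zero fun j hj => by rw [hrow j hj, mul_zero])
  exact ⟨Equiv.ofBijective f (Finite.injective_iff_bijective.1 hf), hfN⟩

theorem Close.eq_of_zero {Γ : AddSubgroup ℝ} {p q : (ℝ ⧸ Γ) × ℝ} (h : Close 0 p q) : p = q := by
  obtain ⟨a, ha⟩ := QuotientAddGroup.mk_surjective p.1
  obtain ⟨a', ha', h1, h2⟩ := h a ha
  have h3 := abs_nonpos_iff.1 h1
  have h4 := abs_nonpos_iff.1 h2
  obtain rfl : a' = a := by linarith
  refine Prod.ext (ha.symm.trans ha') ?_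
  linarith

end FMP

/-! ### Comparison of basis spectra -/

namespace FilteredMatchedPair

open FMP

variable {κ : Type*} [Field κ] {Γ : AddSubgroup ℝ} {H Vup Vdown : Type*}
    [AddCommGroup H] [Module (Lam κ Γ) H] [Module.Finite (Lam κ Γ) H]
    [AddCommGroup Vup] [Module (Lam κ Γ) Vup] [Module (LamUp κ Γ) Vup]
    [IsScalarTower (Lam κ Γ) (LamUp κ Γ) Vup] [Module.Finite (LamUp κ Γ) Vup]
    [AddCommGroup Vdown] [Module (Lam κ Γ) Vdown] [Module (LamDown κ Γ) Vdown]
    [IsScalarTower (Lam κ Γ) (LamDown κ Γ) Vdown] [Module.Finite (LamDown κ Γ) Vdown]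
    {P Q : FilteredMatchedPair κ Γ H Vup Vdown} {e f : Fin (rank κ Γ H) → H}

namespace IsDoublyOrthogonalBasis

/-- The basis of `H / tH` given by a doubly-orthogonal basis. -/
noncomputable def basis (he : P.IsDoublyOrthogonalBasis e) :
    Module.Basis (Fin (rank κ Γ H)) (Lam κ Γ) (H ⧸ Submodule.torsion (Lam κ Γ) H) :=
  Module.Basis.mk he.linearIndependent he.span_eq_top.ge

theorem basis_apply (he : P.IsDoublyOrthogonalBasis e) (i : Fin (rank κ Γ H)) :
    he.basis i = (Submodule.torsion (Lam κ Γ) H).mkQ (e i) :=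
  Module.Basis.mk_apply _ _ i

theorem notMem_torsion (he : P.IsDoublyOrthogonalBasis e) (i : Fin (rank κ Γ H)) :
    e i ∉ Submodule.torsion (Lam κ Γ) H := fun h =>
  he.linearIndependent.ne_zero i ((Submodule.Quotient.mk_eq_zero _).2 h)

theorem sub_sum_mem_torsion (he : P.IsDoublyOrthogonalBasis e) (x : H) :
    x - ∑ i, he.basis.repr ((Submodule.torsion (Lam κ Γ) H).mkQ x) i • e i ∈
      Submodule.torsion (Lam κ Γ) H := by
  rw [← Submodule.Quotient.mk_eq_zero, ← Submodule.mkQ_apply, map_sub, map_sum, sub_eq_zero]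
  conv_lhs => rw [← he.basis.sum_repr ((Submodule.torsion (Lam κ Γ) H).mkQ x)]
  exact Finset.sum_congr rfl fun i _ => by rw [map_smul, he.basis_apply]

/-- Stated for an arbitrary exponent `g` of the coefficient, not only the lowest, so that the same
`g` can be used in `toReal_down_le_sub`. -/
theorem toReal_up_sub_le (he : P.IsDoublyOrthogonalBasis e) {x : H}
    (hx : x ∉ Submodule.torsion (Lam κ Γ) H) {j : Fin (rank κ Γ H)} {g : Γ}
    (hg : (he.basis.repr ((Submodule.torsion (Lam κ Γ) H).mkQ x) j).coeff g ≠ 0) :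
    (P.rhoUp (P.phiUp (e j))).toReal - g ≤ (P.rhoUp (P.phiUp x)).toReal := by
  set c := he.basis.repr ((Submodule.torsion (Lam κ Γ) H).mkQ x)
  have h1 : P.phiUp x = ∑ i, algebraMap (Lam κ Γ) (LamUp κ Γ) (c i) • P.phiUp (e i) := by
    have := P.isNormUp.isSize.map_eq_zero_of_mem_torsion isNovikov_nuUp (φ := P.phiUp)
      (he.sub_sum_mem_torsion x)
    rw [map_sub, sub_eq_zero, map_sum] at this
    rw [this]
    exact Finset.sum_congr rfl fun i _ => by rw [map_smul, algebraMap_smul]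
  have h2 : P.rhoUp (P.phiUp (e j)) - nuUp (algebraMap (Lam κ Γ) (LamUp κ Γ) (c j)) ≤
      P.rhoUp (P.phiUp x) := by
    rw [h1, he.up.orthogonal]
    exact Finset.le_sup
      (f := fun i => P.rhoUp (P.phiUp (e i)) - nuUp (algebraMap (Lam κ Γ) (LamUp κ Γ) (c i)))
      (Finset.mem_univ j)
  have h3 := (isNovikov_nuUp.le_iff (c j) _).1 le_rfl g hg
  have h4 := (EReal.sub_le_sub le_rfl h3).trans h2
  rwa [← P.coe_toReal_rhoUp (P.phiUp_ne_zero (he.notMem_torsion j)),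
    ← P.coe_toReal_rhoUp (P.phiUp_ne_zero hx), ← EReal.coe_sub, EReal.coe_le_coe_iff] at h4

theorem toReal_down_le_sub (he : P.IsDoublyOrthogonalBasis e) {x : H}
    (hx : x ∉ Submodule.torsion (Lam κ Γ) H) {j : Fin (rank κ Γ H)} {g : Γ}
    (hg : (he.basis.repr ((Submodule.torsion (Lam κ Γ) H).mkQ x) j).coeff g ≠ 0) :
    (P.rhoDown (P.phiDown x)).toReal ≤ (P.rhoDown (P.phiDown (e j))).toReal - g := by
  set c := he.basis.repr ((Submodule.torsion (Lam κ Γ) H).mkQ x)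
  have h1 : P.phiDown x = ∑ i, algebraMap (Lam κ Γ) (LamDown κ Γ) (c i) • P.phiDown (e i) := by
    have := P.isNormDown.isSize.map_eq_zero_of_mem_torsion isNovikov_nuDown (φ := P.phiDown)
      (he.sub_sum_mem_torsion x)
    rw [map_sub, sub_eq_zero, map_sum] at this
    rw [this]
    exact Finset.sum_congr rfl fun i _ => by rw [map_smul, algebraMap_smul]
  have h2 : P.rhoDown (P.phiDown x) ≤
      P.rhoDown (P.phiDown (e j)) - nuDown (algebraMap (Lam κ Γ) (LamDown κ Γ) (c j)) := by
    rw [h1, he.down.orthogonal]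
    exact Finset.inf_le
      (f := fun i => P.rhoDown (P.phiDown (e i)) -
        nuDown (algebraMap (Lam κ Γ) (LamDown κ Γ) (c i)))
      (Finset.mem_univ j)
  have h3 : ((g : ℝ) : EReal) ≤ nuDown (algebraMap (Lam κ Γ) (LamDown κ Γ) (c j)) :=
    EReal.neg_le_neg_iff.1 ((isNovikov_nuDown.le_iff (c j) _).1 le_rfl g hg)
  have h4 := h2.trans (EReal.sub_le_sub le_rfl h3)
  rwa [← P.coe_toReal_rhoDown (P.phiDown_ne_zero (he.notMem_torsion j)),
    ← P.coe_toReal_rhoDown (P.phiDown_ne_zero hx), ← EReal.coe_sub, EReal.coe_le_coe_iff] at h4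

end IsDoublyOrthogonalBasis

theorem rel_close_spectrumOf (he : P.IsDoublyOrthogonalBasis e)
    (hf : Q.IsDoublyOrthogonalBasis f)
    (hphiUp : Q.phiUp = P.phiUp) (hphiDown : Q.phiDown = P.phiDown) {t : ℝ}
    (hUp : ∀ x : Vup, x ≠ 0 → |(P.rhoUp x).toReal - (Q.rhoUp x).toReal| ≤ t)
    (hDown : ∀ x : Vdown, x ≠ 0 → |(P.rhoDown x).toReal - (Q.rhoDown x).toReal| ≤ t) :
    Multiset.Rel (Close t) (P.spectrumOf e) (Q.spectrumOf f) := by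
  classical
  set a := fun i => (P.rhoUp (P.phiUp (e i))).toReal with ha
  set b := fun i => (P.rhoDown (P.phiDown (e i))).toReal with hb
  set a' := fun i => (Q.rhoUp (Q.phiUp (f i))).toReal with ha'
  set b' := fun i => (Q.rhoDown (Q.phiDown (f i))).toReal with hb'
  have hcoeff : ∀ y : Lam κ Γ, y ≠ 0 → ∃ g, y.coeff g ≠ 0 := fun y hy => by
    by_contra! h0
    exact hy (AddMonoidAlgebra.ext (Finsupp.ext h0))
  have hA : ∀ i j, hf.basis.toMatrix he.basis j i ≠ 0 →
      ∃ g : Γ, a' j - g ≤ a i + t ∧ b i - t ≤ b' j - g := by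
    intro i j hij
    rw [Module.Basis.toMatrix_apply, he.basis_apply] at hij
    obtain ⟨g, hg⟩ := hcoeff _ hij
    have h1 := hf.toReal_up_sub_le (he.notMem_torsion i) hg
    have h2 := hf.toReal_down_le_sub (he.notMem_torsion i) hg
    have h3 := abs_le.1 (hUp _ (P.phiUp_ne_zero (he.notMem_torsion i)))
    have h4 := abs_le.1 (hDown _ (P.phiDown_ne_zero (he.notMem_torsion i)))
    refine ⟨g, ?_, ?_⟩
    · refine h1.trans ?_
      rw [hphiUp]; linarith
    · refine le_trans ?_ h2
      rw [hphiDown]; linarith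
  have hB : ∀ i j, he.basis.toMatrix hf.basis i j ≠ 0 →
      ∃ g : Γ, a i - g ≤ a' j + t ∧ b' j - t ≤ b i - g := by
    intro i j hij
    rw [Module.Basis.toMatrix_apply, hf.basis_apply] at hij
    obtain ⟨g, hg⟩ := hcoeff _ hij
    have h1 := he.toReal_up_sub_le (hf.notMem_torsion j) hg
    have h2 := he.toReal_down_le_sub (hf.notMem_torsion j) hg
    have h3 := abs_le.1 (hUp _ (P.phiUp_ne_zero (hf.notMem_torsion j)))
    have h4 := abs_le.1 (hDown _ (P.phiDown_ne_zero (hf.notMem_torsion j)))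
    refine ⟨g, ?_, ?_⟩
    · refine h1.trans ?_
      rw [ha']; simp only [hphiUp]; linarith
    · refine le_trans ?_ h2
      rw [hb']; simp only [hphiDown]; linarith
  obtain ⟨σ, hσ⟩ := exists_perm_forall_mem (he.basis.toMatrix_mul_toMatrix_flip hf.basis)
    (fun i => Finset.univ.filter fun j => ∃ g : Γ, |a' j - g - a i| ≤ t ∧ |b' j - g - b i| ≤ t)
    (fun i => a i - b i) (by
      intro i i' j hle hij hij'
      obtain ⟨g, h1, h2⟩ := hA i j hij
      obtain ⟨h, h3, h4⟩ := hB i' j hij'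
      simp only [Finset.mem_filter, Finset.mem_univ, true_and]
      by_contra! hcon
      -- Given `h1` and `h2`, either alternative yields `b' j - a' j > b i - a i`. Likewise `h3`,
      -- `h4` and `h6` yield `b' j - a' j < b i' - a i'`. Together they contradict `hle`.
      have h5 : a' j - g - a i < -t ∨ t < b' j - g - b i := by
        by_contra! h5
        exact absurd (hcon.1 g (abs_le.2 ⟨h5.1, by linarith⟩))
          (not_lt.2 (abs_le.2 ⟨by linarith, h5.2⟩))
      have h6 : t < a' j + h - a i' ∨ b' j + h - b i' < -t := by
        by_contra! h6
        have h7 := hcon.2 (-h)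
        rw [AddSubgroup.coe_neg, sub_neg_eq_add, sub_neg_eq_add] at h7
        exact absurd (h7 (abs_le.2 ⟨by linarith, h6.1⟩))
          (not_lt.2 (abs_le.2 ⟨h6.2, by linarith⟩))
      rcases h5 with h5 | h5 <;> rcases h6 with h6 | h6 <;> linarith)
  have hperm : Q.spectrumOf f = (Finset.univ : Finset (Fin (rank κ Γ H))).val.map fun i =>
      ((a' (σ i) : ℝ ⧸ Γ), b' (σ i) - a' (σ i)) := by
    rw [spectrumOf]
    conv_lhs => rw [← Multiset.map_univ_val_equiv σ, Multiset.map_map]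
    rfl
  rw [hperm, spectrumOf, Multiset.rel_map]
  refine Multiset.rel_refl_of_refl_on fun i _ => ?_
  obtain ⟨g, h1, h2⟩ := (Finset.mem_filter.1 (hσ i)).2
  intro r hr
  obtain ⟨γ, hγ⟩ : ∃ γ : Γ, r = a i + γ := by
    have := (QuotientAddGroup.eq (s := Γ)).1 hr.symm
    exact ⟨⟨_, this⟩, by simp [ha]⟩
  refine ⟨a' (σ i) - g + γ, ?_, ?_, ?_⟩
  · refine (QuotientAddGroup.eq (s := Γ)).2 ?_
    have : -(a' (σ i) - g + γ) + a' (σ i) = ((g - γ : Γ) : ℝ) := by push_cast; ring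
    rw [this]
    exact (g - γ).2
  · rw [hγ]
    convert h1 using 2
    ring
  · rw [hγ]
    convert h2 using 2
    simp only [ha, hb]
    ring

theorem hasBasisSpectrum_of_exists (h : ∃ e, P.IsDoublyOrthogonalBasis e) :
    P.HasBasisSpectrum := by
  refine ⟨h, fun e he => ?_⟩
  rw [basisSpectrum, dif_pos h]
  have := rel_close_spectrumOf he h.choose_spec rfl rfl (t := 0) (by simp) (by simp)
  exact Multiset.rel_eq.1 (this.mono fun _ _ _ _ hab => hab.eq_of_zero)

end FilteredMatchedPair

namespace FMP

/-! ### Discrete subgroups of the reals -/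

/-- Every ideal of a localization is the extension of its contraction. -/
theorem isPrincipalIdealRing_of_isLocalization {R : Type*} [CommRing R] [IsPrincipalIdealRing R]
    (M : Submonoid R) (S : Type*) [CommRing S] [Algebra R S] [IsLocalization M S] :
    IsPrincipalIdealRing S where
  principal J := by
    obtain ⟨a, ha⟩ := (IsPrincipalIdealRing.principal (J.under R)).principal
    refine ⟨algebraMap R S a, ?_⟩
    rw [← IsLocalization.map_under M S J, ha, ← Ideal.span, Ideal.map_span,
      Set.image_singleton]

/-- A discrete `Γ` is cyclic, so `Λ` is a quotient of the Laurent polynomial ring. Only surjectivity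
of `ℤ → Γ` is used, which includes `Γ = 0`. -/
theorem isPrincipalIdealRing_lam (κ : Type*) [Field κ] (Γ : AddSubgroup ℝ)
    [DiscreteTopology Γ] : IsPrincipalIdealRing (Lam κ Γ) := by
  obtain ⟨ε, hε, hiso⟩ := Metric.isOpen_singleton_iff.1 (isOpen_discrete ({0} : Set Γ))
  obtain ⟨b, hb⟩ := AddSubgroup.cyclic_of_isolated_zero (H := Γ) hε (by
    rw [Set.disjoint_left]
    rintro x hx ⟨h0, hxε⟩
    refine h0.ne' (congrArg Subtype.val (hiso ⟨x, hx⟩ ?_))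
    rw [Subtype.dist_eq, Real.dist_eq, AddSubgroup.coe_zero, sub_zero, abs_of_pos h0]
    exact hxε)
  have hbΓ : b ∈ Γ := hb ▸ AddSubgroup.subset_closure rfl
  set z : ℤ →+ Γ := zmultiplesHom Γ ⟨b, hbΓ⟩ with hz
  have hzs : Function.Surjective z := by
    rintro ⟨x, hx⟩
    have hx' := hx
    rw [hb, AddSubgroup.mem_closure_singleton] at hx'
    obtain ⟨n, hn⟩ := hx'
    exact ⟨n, Subtype.ext (by simpa [hz] using hn)⟩
  have : IsPrincipalIdealRing (LaurentPolynomial κ) :=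
    isPrincipalIdealRing_of_isLocalization
      (Submonoid.powers (Polynomial.X : Polynomial κ)) _
  refine IsPrincipalIdealRing.of_surjective
    (AddMonoidAlgebra.mapDomainRingHom κ z : LaurentPolynomial κ →+* Lam κ Γ) fun y => ?_
  induction y using AddMonoidAlgebra.induction_linear with
  | zero => exact ⟨0, map_zero _⟩
  | add x y hx hy =>
    obtain ⟨x', rfl⟩ := hx
    obtain ⟨y', rfl⟩ := hy
    exact ⟨x' + y', map_add _ _ _⟩
  | single g a =>
    obtain ⟨n, rfl⟩ := hzs g
    exact ⟨AddMonoidAlgebra.single n a, AddMonoidAlgebra.mapDomain_single⟩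

theorem exists_least_of_finite_classes {Γ : AddSubgroup ℝ} [DiscreteTopology Γ] {S : Set ℝ}
    (hne : S.Nonempty) (hbdd : BddBelow S)
    (hfin : ((fun x : ℝ => (x : ℝ ⧸ Γ)) '' S).Finite) : ∃ m, IsLeast S m := by
  obtain ⟨y, hy⟩ := hne
  obtain ⟨L, hL⟩ := hbdd
  have hclass : ∀ c : ℝ ⧸ Γ, {x : ℝ | (x : ℝ ⧸ Γ) = c ∧ L ≤ x ∧ x ≤ y}.Finite := by
    intro c
    obtain ⟨r, rfl⟩ := QuotientAddGroup.mk_surjective c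
    -- The radius bounds `|x - r|` whenever `L ≤ x ≤ y`.
    have hΓ : (Metric.closedBall 0 (|L - r| + |y - r|) ∩ (Γ : Set ℝ)).Finite :=
      Metric.finite_isBounded_inter_isClosed DiscreteTopology.isDiscrete
        Metric.isBounded_closedBall AddSubgroup.isClosed_of_discrete
    refine (hΓ.image fun x => r + x).subset ?_
    rintro x ⟨hx, h1, h2⟩
    refine ⟨-r + x, ⟨?_, (QuotientAddGroup.eq (s := Γ)).1 hx.symm⟩, by simp⟩
    rw [mem_closedBall_zero_iff, Real.norm_eq_abs, abs_le]
    constructor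
    · linarith [neg_abs_le (L - r), abs_nonneg (y - r)]
    · linarith [le_abs_self (y - r), abs_nonneg (L - r)]
  have hSfin : {x ∈ S | x ≤ y}.Finite := by
    refine (hfin.biUnion fun c _ => hclass c).subset ?_
    rintro x ⟨hx, hxy⟩
    exact Set.mem_biUnion ⟨x, hx, rfl⟩ ⟨rfl, hL hx, hxy⟩
  obtain ⟨m, ⟨hm, hmy⟩, hmin⟩ := Set.exists_min_image _ id hSfin ⟨y, hy, le_rfl⟩
  refine ⟨m, hm, fun x hx => ?_⟩
  rcases le_total x y with h | h
  · exact hmin x ⟨hx, h⟩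
  · exact hmy.trans h

variable {κ : Type*} [Field κ] {Γ : AddSubgroup ℝ} {w : Γ →+ ℝ}

/-- Only finitely many classes modulo `Γ` are sizes of vectors of a finite-dimensional space:
vectors with sizes in distinct classes are linearly independent. -/
theorem IsSize.finite_classes {K : Type*} [CommRing K] [Algebra (Lam κ Γ) K] {v : K → EReal}
    {V : Type*} [AddCommGroup V] [Module K V] [Module.Finite K V] {ρ : V → EReal}
    (hv : IsNovikov κ w v) (hw : ∀ g, w g ∈ Γ) (h : IsSize v ρ) :
    {c : ℝ ⧸ Γ | ∃ x : V, x ≠ 0 ∧ ((ρ x).toReal : ℝ ⧸ Γ) = c}.Finite := by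
  classical
  have : Nontrivial K := hv.isField.nontrivial
  set T := {c : ℝ ⧸ Γ | ∃ x : V, x ≠ 0 ∧ ((ρ x).toReal : ℝ ⧸ Γ) = c}
  choose x hx0 hx using fun c : T => c.2
  suffices hli : LinearIndependent K x from
    Cardinal.lt_aleph0_iff_finite.1 hli.lt_aleph0_of_finite
  rw [linearIndependent_iff']
  intro s c hsum
  by_contra! hcon
  obtain ⟨i₁, hi₁, hci₁⟩ := hcon
  have hy0 : ∀ i, c i ≠ 0 → c i • x i ≠ 0 := fun i hi h0 =>
    hx0 i (h.eq_zero_of_smul_eq_zero hv hi h0)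
  have hclass : ∀ i, c i ≠ 0 → ((ρ (c i • x i)).toReal : ℝ ⧸ Γ) = i := by
    intro i hi
    obtain ⟨g, a, -, hg, -⟩ := hv.exists_leading _ hi
    rw [h.smul, ← h.coe_toReal (hx0 i), hg, ← EReal.coe_sub, EReal.toReal_coe, ← hx i]
    refine (QuotientAddGroup.eq (s := Γ)).2 ?_
    simpa using hw g
  -- Nonzero terms have sizes in distinct classes, so the largest is strictly dominant and the sum
  -- cannot vanish.
  obtain ⟨k, hk, hmax⟩ := Finset.exists_max_image (s.filter fun i => c i ≠ 0)
    (fun i => (ρ (c i • x i)).toReal) ⟨i₁, by simp [hi₁, hci₁]⟩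
  obtain ⟨hks, hck⟩ := Finset.mem_filter.1 hk
  rw [← Finset.add_sum_erase s _ hks] at hsum
  have hlt : ρ (∑ i ∈ s.erase k, c i • x i) < ρ (c k • x k) := by
    refine h.sum_lt _ _ ?_ fun i hi => ?_
    · exact bot_lt_iff_ne_bot.2 fun h0 => hy0 k hck ((h.eq_bot_iff _).1 h0)
    · by_cases hci : c i = 0
      · rw [hci, zero_smul, h.map_zero]
        exact bot_lt_iff_ne_bot.2 fun h0 => hy0 k hck ((h.eq_bot_iff _).1 h0)
      · have h1 := hmax i (by simp [Finset.mem_of_mem_erase hi, hci])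
        rw [← h.coe_toReal (hy0 i hci), ← h.coe_toReal (hy0 k hck), EReal.coe_lt_coe_iff]
        refine lt_of_le_of_ne h1 fun h2 => Finset.ne_of_mem_erase hi (Subtype.ext ?_)
        rw [← hclass i hci, ← hclass k hck, h2]
  rw [add_comm] at hsum
  have h3 := h.add_eq_right hv hlt
  rw [hsum, h.map_zero] at h3
  exact hy0 k hck ((h.eq_bot_iff _).1 h3.symm)

/-! ### Improving a basis -/

section Improve

variable {H : Type*} [AddCommGroup H] [Module (Lam κ Γ) H]

/-- `e` projects to a generating family of `H / tH`. -/
def Generates (κ : Type*) [Field κ] (Γ : AddSubgroup ℝ) {H : Type*} [AddCommGroup H]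
    [Module (Lam κ Γ) H] {d : ℕ} (e : Fin d → H) : Prop :=
  Submodule.span (Lam κ Γ)
    (Set.range fun i => (Submodule.torsion (Lam κ Γ) H).mkQ (e i)) = ⊤

theorem Generates.linearIndependent [Module.Finite (Lam κ Γ) H] {e : Fin (rank κ Γ H) → H}
    (he : Generates κ Γ e) :
    LinearIndependent (Lam κ Γ) fun i => (Submodule.torsion (Lam κ Γ) H).mkQ (e i) :=
  linearIndependent_of_top_le_span_of_card_eq_finrank he.ge
    (by rw [Fintype.card_fin, finrank_quotient_torsion, rank])

theorem Generates.notMem_torsion [Module.Finite (Lam κ Γ) H] {e : Fin (rank κ Γ H) → H}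
    (he : Generates κ Γ e) (i : Fin (rank κ Γ H)) : e i ∉ Submodule.torsion (Lam κ Γ) H :=
  fun h => he.linearIndependent.ne_zero i ((Submodule.Quotient.mk_eq_zero _).2 h)

/-- Since `c k = 1`, the old `e k` is recovered from the new one by subtracting multiples of the
others. -/
theorem Generates.update {d : ℕ} {e : Fin d → H} (he : Generates κ Γ e) (k : Fin d)
    (c : Fin d → Lam κ Γ) (hc : c k = 1) :
    Generates κ Γ (Function.update e k (∑ i, c i • e i)) := by
  set π := (Submodule.torsion (Lam κ Γ) H).mkQ
  set e' := Function.update e k (∑ i, c i • e i) with he'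
  set W := Submodule.span (Lam κ Γ) (Set.range fun i => π (e' i))
  have hmem : ∀ i, π (e' i) ∈ W := fun i => Submodule.subset_span ⟨i, rfl⟩
  have hne : ∀ i, i ≠ k → π (e i) ∈ W := fun i hi => by
    have := hmem i
    rwa [he', Function.update_of_ne hi] at this
  have hk : π (e k) ∈ W := by
    have h1 := hmem k
    rw [he', Function.update_self, ← Finset.add_sum_erase _ _ (Finset.mem_univ k), hc, one_smul,
      map_add] at h1
    refine (Submodule.add_mem_iff_left _ ?_).1 h1
    rw [map_sum]
    refine sum_mem fun i hi => ?_
    rw [map_smul]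
    exact Submodule.smul_mem _ _ (hne i (Finset.ne_of_mem_erase hi))
  refine top_unique (he.ge.trans (Submodule.span_le.2 ?_))
  rintro _ ⟨i, rfl⟩
  by_cases hi : i = k
  · exact hi ▸ hk
  · exact hne i hi

variable {K : Type*} [CommRing K] [Algebra (Lam κ Γ) K] {v : K → EReal}
  {V : Type*} [AddCommGroup V] [Module K V] {ρ : V → EReal} [Module (Lam κ Γ) V]
  [IsScalarTower (Lam κ Γ) K V] {φ : H →ₗ[Lam κ Γ] V}
  {K' : Type*} [CommRing K'] [Algebra (Lam κ Γ) K'] {v' : K' → EReal}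
  {V' : Type*} [AddCommGroup V'] [Module K' V'] {ρ' : V' → EReal} [Module (Lam κ Γ) V']
  [IsScalarTower (Lam κ Γ) K' V'] {φ' : H →ₗ[Lam κ Γ] V'}

theorem IsSize.map_single_smul (hv : IsNovikov κ w v) (h : IsSize v ρ) (g : Γ) {a : κ}
    (ha : a ≠ 0) (x : H) :
    ρ (φ ((AddMonoidAlgebra.single g a : Lam κ Γ) • x)) = ρ (φ x) - (w g : ℝ) := by
  rw [map_smul, ← algebraMap_smul K (AddMonoidAlgebra.single g a : Lam κ Γ) (φ x), h.smul,
    hv.map_single g ha]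

variable [Module.Finite (Lam κ Γ) H]

/-- If a generating family is not orthogonal for the first size, replacing one of its members
decreases the first size of this member, and does not increase the second. -/
theorem exists_improvement (hv : IsNovikov κ w v) (hφ : IsBaseChange K φ) (hρ : IsSize v ρ)
    (hv' : IsNovikov κ (-w) v') (hφ' : IsBaseChange K' φ') (hρ' : IsSize v' ρ')
    {e : Fin (rank κ Γ H) → H} (he : Generates κ Γ e) (c : Fin (rank κ Γ H) → K)
    {i₀ : Fin (rank κ Γ H)} (hlt : ρ (∑ i, c i • φ (e i)) < ρ (φ (e i₀)) - v (c i₀)) :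
    ∃ e' : Fin (rank κ Γ H) → H, Generates κ Γ e' ∧
      ∑ i, ((ρ (φ (e' i))).toReal + (ρ' (φ' (e' i))).toReal) <
        ∑ i, ((ρ (φ (e i))).toReal + (ρ' (φ' (e i))).toReal) := by
  classical
  have he0 : ∀ i, φ (e i) ≠ 0 := fun i => hv.map_ne_zero hφ (he.notMem_torsion i)
  have he0' : ∀ i, φ' (e i) ≠ 0 := fun i => hv'.map_ne_zero hφ' (he.notMem_torsion i)
  obtain ⟨i₁, -, hi₁⟩ := Finset.exists_max_image Finset.univ
    (fun i => ρ (φ (e i)) - v (c i)) ⟨i₀, Finset.mem_univ _⟩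
  set B := ρ (φ (e i₁)) - v (c i₁) with hB
  replace hlt : ρ (∑ i, c i • φ (e i)) < B := hlt.trans_le (hi₁ i₀ (Finset.mem_univ _))
  have hBbot : ⊥ < B := bot_le.trans_lt hlt
  set S : Finset (Fin (rank κ Γ H)) :=
    Finset.univ.filter fun i => ρ (φ (e i)) - v (c i) = B with hS
  have hmemS : ∀ i, i ∈ S ↔ ρ (φ (e i)) - v (c i) = B := fun i => by simp [hS]
  have hcS : ∀ i ∈ S, c i ≠ 0 := by
    intro i hi h0
    have := (hmemS i).1 hi
    rw [h0, hv.map_zero', EReal.sub_top] at this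
    exact hBbot.ne this
  choose! g a ha hg hlead using fun i => hv.exists_leading (c i)
  have hSB : ∀ i ∈ S, ρ (φ (e i)) = B + (w (g i) : ℝ) := by
    intro i hi
    rw [← (hmemS i).1 hi, hg i (hcS i hi), ← hρ.coe_toReal (he0 i), ← EReal.coe_sub,
      ← EReal.coe_add, sub_add_cancel]
  -- Keeping only the leading monomials at the indices that attain `B` discards terms of size below
  -- `B`, so the cancellation survives with coefficients in `Λ`.
  set m : Fin (rank κ Γ H) → Lam κ Γ := fun i =>
    if i ∈ S then AddMonoidAlgebra.single (g i) (a i) else 0 with hm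
  set x := ∑ i, m i • e i with hx
  have hρx : ρ (φ x) < B := by
    have h1 : φ x = ∑ i, c i • φ (e i) -
        ∑ i, (c i - algebraMap (Lam κ Γ) K (m i)) • φ (e i) := by
      rw [← Finset.sum_sub_distrib, hx, map_sum]
      refine Finset.sum_congr rfl fun i _ => ?_
      rw [← sub_smul, sub_sub_cancel, map_smul, algebraMap_smul]
    rw [h1]
    refine (hρ.sub_le hv _ _).trans_lt (max_lt hlt (hρ.sum_lt _ _ hBbot fun i _ => ?_))
    rw [hρ.smul]
    by_cases hi : i ∈ S
    · have hmi : m i = AddMonoidAlgebra.single (g i) (a i) := if_pos hi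
      rw [← (hmemS i).1 hi, hmi, ← hρ.coe_toReal (he0 i)]
      refine EReal.sub_lt_sub_of_le_of_gt le_rfl ?_ (EReal.coe_ne_top _) (EReal.coe_ne_bot _)
      rw [hg i (hcS i hi)]
      exact hlead i (hcS i hi)
    · have hmi : m i = 0 := if_neg hi
      rw [hmi, map_zero, sub_zero]
      exact lt_of_le_of_ne (hi₁ i (Finset.mem_univ _)) fun h0 => hi ((hmemS i).2 h0)
  -- Any `k ∈ S` would lower the first size; this `k` has the term of largest second size in `x`,
  -- which keeps the second size from growing.
  obtain ⟨k, hkS, hk⟩ := Finset.exists_max_image S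
    (fun i => ρ' (φ' (e i)) + (w (g i) : ℝ)) ⟨i₁, (hmemS i₁).2 rfl⟩
  -- Multiplying by `u` makes the coefficient of `e k` in `x` equal to `1`.
  set u : Lam κ Γ := AddMonoidAlgebra.single (-g k) (a k)⁻¹ with hu
  have hak : (a k)⁻¹ ≠ 0 := inv_ne_zero (ha k (hcS k hkS))
  have hux : u • x = ∑ i, (u * m i) • e i := by
    rw [hx, Finset.smul_sum]
    exact Finset.sum_congr rfl fun i _ => smul_smul _ _ _
  have hgen := he.update k (fun i => u * m i) (by
    simp only [hm, if_pos hkS, hu, AddMonoidAlgebra.single_mul_single, neg_add_cancel,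
      inv_mul_cancel₀ (ha k (hcS k hkS)), AddMonoidAlgebra.one_def])
  rw [← hux] at hgen
  refine ⟨_, hgen, ?_⟩
  have hux0 := hgen.notMem_torsion k
  rw [Function.update_self] at hux0
  have h1 : (ρ (φ (u • x))).toReal < (ρ (φ (e k))).toReal := by
    rw [← EReal.coe_lt_coe_iff, hρ.coe_toReal (hv.map_ne_zero hφ hux0), hρ.coe_toReal (he0 k),
      hSB k hkS, hρ.map_single_smul hv _ hak, map_neg, EReal.coe_neg, sub_eq_add_neg, neg_neg]
    exact EReal.add_lt_add_right_coe hρx _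
  have h2 : (ρ' (φ' (u • x))).toReal ≤ (ρ' (φ' (e k))).toReal := by
    rw [← EReal.coe_le_coe_iff, hρ'.coe_toReal (hv'.map_ne_zero hφ' hux0),
      hρ'.coe_toReal (he0' k), hρ'.map_single_smul hv' _ hak]
    have h3 : ρ' (φ' x) ≤ ρ' (φ' (e k)) + (w (g k) : ℝ) := by
      rw [hx, map_sum]
      refine hρ'.sum_le _ _ fun i _ => ?_
      by_cases hi : i ∈ S
      · have hmi : m i = AddMonoidAlgebra.single (g i) (a i) := if_pos hi
        rw [hmi, hρ'.map_single_smul hv' _ (ha i (hcS i hi)), AddMonoidHom.neg_apply,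
          EReal.coe_neg, sub_eq_add_neg, neg_neg]
        exact hk i hi
      · have hmi : m i = 0 := if_neg hi
        rw [hmi, zero_smul, map_zero, hρ'.map_zero]
        exact bot_le
    rw [AddMonoidHom.neg_apply, map_neg, neg_neg]
    refine (EReal.sub_le_sub h3 le_rfl).trans ?_
    rw [← hρ'.coe_toReal (he0' k), ← EReal.coe_add, ← EReal.coe_sub, add_sub_cancel_right]
  refine Finset.sum_lt_sum (fun i _ => ?_) ⟨k, Finset.mem_univ _, ?_⟩
  · by_cases hi : i = k
    · subst hi
      rw [Function.update_self]
      exact add_le_add h1.le h2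
    · rw [Function.update_of_ne hi]
  · rw [Function.update_self]
    exact add_lt_add_of_lt_of_le h1 h2

end Improve

/-! ### From orthogonality inequalities and generating families to bases -/

section Orthogonal

variable {H : Type*} [AddCommGroup H] [Module (Lam κ Γ) H]
  {K : Type*} [CommRing K] [Algebra (Lam κ Γ) K] {v : K → EReal}
  {V : Type*} [AddCommGroup V] [Module K V] {ρ : V → EReal}

theorem IsSize.linearIndependent {d : ℕ} (hv : IsNovikov κ w v) (hρ : IsSize v ρ)
    {x : Fin d → V} (hx : ∀ i, x i ≠ 0)
    (horth : ∀ (c : Fin d → K) (i), ρ (x i) - v (c i) ≤ ρ (∑ i, c i • x i)) :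
    LinearIndependent K x := by
  rw [Fintype.linearIndependent_iff]
  intro c hc i
  have h1 := horth c i
  rw [hc, hρ.map_zero] at h1
  by_contra hci
  rw [← hρ.coe_toReal (hx i), ← hv.coe_toReal hci, ← EReal.coe_sub] at h1
  exact EReal.coe_ne_bot _ (le_bot_iff.1 h1)

theorem IsSize.map_sum_eq_sup {d : ℕ} (hρ : IsSize v ρ) {x : Fin d → V}
    (horth : ∀ (c : Fin d → K) (i), ρ (x i) - v (c i) ≤ ρ (∑ i, c i • x i)) (c : Fin d → K) :
    ρ (∑ i, c i • x i) = Finset.univ.sup fun i => ρ (x i) - v (c i) := by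
  refine le_antisymm (hρ.sum_le _ _ fun i hi => ?_) (Finset.sup_le fun i _ => horth c i)
  rw [hρ.smul]
  exact Finset.le_sup (f := fun i => ρ (x i) - v (c i)) hi

theorem Generates.span_eq_top [Module (Lam κ Γ) V] [IsScalarTower (Lam κ Γ) K V]
    {φ : H →ₗ[Lam κ Γ] V} (hv : IsNovikov κ w v) (hφ : IsBaseChange K φ)
    (hρ : IsSize v ρ) {d : ℕ} {e : Fin d → H} (he : Generates κ Γ e) :
    Submodule.span K (Set.range fun i => φ (e i)) = ⊤ := by
  refine top_unique fun y _ => ?_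
  induction y using hφ.inductionOn with
  | zero => exact zero_mem _
  | smul c y hy => exact Submodule.smul_mem _ _ (hy trivial)
  | add y z hy hz => exact add_mem (hy trivial) (hz trivial)
  | tmul x =>
    have hx : (Submodule.torsion (Lam κ Γ) H).mkQ x ∈ Submodule.span (Lam κ Γ)
        (Set.range fun i => (Submodule.torsion (Lam κ Γ) H).mkQ (e i)) := he ▸ Submodule.mem_top
    obtain ⟨c, hc⟩ := (Submodule.mem_span_range_iff_exists_fun _).1 hx
    have h1 : x - ∑ i, c i • e i ∈ Submodule.torsion (Lam κ Γ) H := by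
      rw [← Submodule.Quotient.mk_eq_zero, ← Submodule.mkQ_apply, map_sub, map_sum, sub_eq_zero,
        ← hc]
      simp only [map_smul]
    have h2 := hρ.map_eq_zero_of_mem_torsion hv (φ := φ) h1
    rw [map_sub, sub_eq_zero, map_sum] at h2
    rw [h2]
    refine sum_mem fun i _ => ?_
    rw [map_smul, ← algebraMap_smul K (c i)]
    exact Submodule.smul_mem _ _ (Submodule.subset_span ⟨i, rfl⟩)

theorem exists_generates (κ : Type*) [Field κ] (Γ : AddSubgroup ℝ) [DiscreteTopology Γ]
    (H : Type*) [AddCommGroup H] [Module (Lam κ Γ) H] [Module.Finite (Lam κ Γ) H] :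
    ∃ e : Fin (rank κ Γ H) → H, Generates κ Γ e := by
  have := isPrincipalIdealRing_lam κ Γ
  have : Module.Free (Lam κ Γ) (H ⧸ Submodule.torsion (Lam κ Γ) H) :=
    Module.free_of_finite_type_torsion_free'
  let b := Module.finBasisOfFinrankEq (Lam κ Γ) (H ⧸ Submodule.torsion (Lam κ Γ) H)
    (n := rank κ Γ H) finrank_quotient_torsion
  choose e he using fun i => (Submodule.torsion (Lam κ Γ) H).mkQ_surjective (b i)
  refine ⟨e, ?_⟩
  rw [Generates]
  simp only [he]
  exact b.span_eq

end Orthogonal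

end FMP

/-! ### Existence of doubly-orthogonal bases -/

namespace FilteredMatchedPair

open FMP

variable {κ : Type*} [Field κ] {Γ : AddSubgroup ℝ} {H Vup Vdown : Type*}
    [AddCommGroup H] [Module (Lam κ Γ) H] [Module.Finite (Lam κ Γ) H]
    [AddCommGroup Vup] [Module (Lam κ Γ) Vup] [Module (LamUp κ Γ) Vup]
    [IsScalarTower (Lam κ Γ) (LamUp κ Γ) Vup] [Module.Finite (LamUp κ Γ) Vup]
    [AddCommGroup Vdown] [Module (Lam κ Γ) Vdown] [Module (LamDown κ Γ) Vdown]
    [IsScalarTower (Lam κ Γ) (LamDown κ Γ) Vdown] [Module.Finite (LamDown κ Γ) Vdown]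
    (P : FilteredMatchedPair κ Γ H Vup Vdown)

/-- Over a discrete group, some generating family minimizes the sum of the two sizes. -/
theorem exists_minimal_generates [DiscreteTopology Γ] :
    ∃ e : Fin (rank κ Γ H) → H, Generates κ Γ e ∧ ∀ e' : Fin (rank κ Γ H) → H,
      Generates κ Γ e' →
      ∑ i, ((P.rhoUp (P.phiUp (e i))).toReal + (-P.rhoDown (P.phiDown (e i))).toReal) ≤
        ∑ i, ((P.rhoUp (P.phiUp (e' i))).toReal + (-P.rhoDown (P.phiDown (e' i))).toReal) := by
  obtain ⟨C, hC⟩ := exists_size_bound isNovikov_nuUp P.isBaseChange_up P.isNormUp.isSize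
    isNovikov_nuDown P.isBaseChange_down P.isNormDown.isSize
  have hfin := P.isNormUp.isSize.finite_classes isNovikov_nuUp fun g => g.2
  have hfin' := P.isNormDown.isSize.finite_classes isNovikov_nuDown fun g => Γ.neg_mem g.2
  set T := {c : ℝ ⧸ Γ | ∃ x : Vup, x ≠ 0 ∧ ((P.rhoUp x).toReal : ℝ ⧸ Γ) = c}
  set T' := {c : ℝ ⧸ Γ | ∃ x : Vdown, x ≠ 0 ∧ ((-P.rhoDown x).toReal : ℝ ⧸ Γ) = c}
  have : Finite T := hfin
  have : Finite T' := hfin'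
  set s : (Fin (rank κ Γ H) → H) → ℝ := fun e =>
    ∑ i, ((P.rhoUp (P.phiUp (e i))).toReal + (-P.rhoDown (P.phiDown (e i))).toReal) with hs
  obtain ⟨e₀, he₀⟩ := exists_generates κ Γ H
  obtain ⟨_, ⟨e, he, rfl⟩, hmin⟩ := exists_least_of_finite_classes (Γ := Γ)
    (S := s '' {e | Generates κ Γ e}) ⟨_, e₀, he₀, rfl⟩ (by
      refine ⟨∑ _i : Fin (rank κ Γ H), C, ?_⟩
      rintro _ ⟨e, he, rfl⟩
      exact Finset.sum_le_sum fun i _ => hC _ (Generates.notMem_torsion he i)) (by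
      -- The class of a total is the sum of the classes of its terms, each from a finite set.
      refine (Set.finite_range fun u : Fin (rank κ Γ H) → T × T' =>
        ∑ i, (((u i).1 : ℝ ⧸ Γ) + ((u i).2 : ℝ ⧸ Γ))).subset ?_
      rintro _ ⟨_, ⟨e, he, rfl⟩, rfl⟩
      refine ⟨fun i => (⟨_, _, P.phiUp_ne_zero (Generates.notMem_torsion he i), rfl⟩,
        ⟨_, _, P.phiDown_ne_zero (Generates.notMem_torsion he i), rfl⟩), ?_⟩
      exact (map_sum (QuotientAddGroup.mk' Γ) _ _).symm)
  exact ⟨e, he, fun e' he' => hmin ⟨e', he', rfl⟩⟩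

theorem exists_isDoublyOrthogonalBasis [DiscreteTopology Γ] :
    ∃ e, P.IsDoublyOrthogonalBasis e := by
  obtain ⟨e, he, hmin⟩ := P.exists_minimal_generates
  have hup : ∀ (c : Fin (rank κ Γ H) → LamUp κ Γ) (i),
      P.rhoUp (P.phiUp (e i)) - nuUp (c i) ≤ P.rhoUp (∑ i, c i • P.phiUp (e i)) := by
    intro c i
    by_contra! hlt
    obtain ⟨e', he', hlt'⟩ := exists_improvement isNovikov_nuUp P.isBaseChange_up
      P.isNormUp.isSize isNovikov_nuDown P.isBaseChange_down P.isNormDown.isSize he c hlt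
    exact absurd (hmin e' he') (not_le.2 hlt')
  have hdown : ∀ (c : Fin (rank κ Γ H) → LamDown κ Γ) (i),
      -P.rhoDown (P.phiDown (e i)) - -nuDown (c i) ≤ -P.rhoDown (∑ i, c i • P.phiDown (e i)) := by
    intro c i
    by_contra! hlt
    -- The two sides exchange roles; the total being minimized is symmetric in them.
    obtain ⟨e', he', hlt'⟩ := exists_improvement isNovikov_nuDown P.isBaseChange_down
      P.isNormDown.isSize (by rw [neg_neg]; exact isNovikov_nuUp) P.isBaseChange_up
      P.isNormUp.isSize he c hlt
    refine absurd (hmin e' he') (not_le.2 ?_)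
    simpa only [add_comm] using hlt'
  refine ⟨e, he.linearIndependent, he, ⟨?_, ?_, ?_⟩, ?_, ?_, fun c => ?_⟩
  · exact P.isNormUp.isSize.linearIndependent isNovikov_nuUp
      (fun i => P.phiUp_ne_zero (he.notMem_torsion i)) hup
  · exact he.span_eq_top isNovikov_nuUp P.isBaseChange_up P.isNormUp.isSize
  · exact P.isNormUp.isSize.map_sum_eq_sup hup
  · exact P.isNormDown.isSize.linearIndependent isNovikov_nuDown
      (fun i => P.phiDown_ne_zero (he.notMem_torsion i)) hdown
  · exact he.span_eq_top isNovikov_nuDown P.isBaseChange_down P.isNormDown.isSize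
  -- `nuDown (c i)` is infinite when `c i = 0`, so the sign rule in `EReal` rests on the finiteness
  -- of the other term.
  · have h0 : ∀ i, P.rhoDown (P.phiDown (e i)) - nuDown (c i) =
        -(-P.rhoDown (P.phiDown (e i)) - -nuDown (c i)) := by
      intro i
      have h1 := P.coe_toReal_rhoDown (P.phiDown_ne_zero (he.notMem_torsion i))
      rw [EReal.neg_sub (Or.inl ?_) (Or.inl ?_), neg_neg, sub_eq_add_neg]
      · rw [← h1, ← EReal.coe_neg]; exact EReal.coe_ne_bot _
      · rw [← h1, ← EReal.coe_neg]; exact EReal.coe_ne_top _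
    refine le_antisymm (Finset.le_inf fun i _ => ?_) ?_
    · rw [h0, EReal.le_neg]
      exact hdown c i
    · have h2 := (P.isNormDown.isSize.map_sum_eq_sup hdown c).le
      rw [EReal.neg_le] at h2
      refine le_trans ?_ h2
      rw [EReal.le_neg]
      refine Finset.sup_le fun i hi => ?_
      rw [EReal.le_neg, ← h0]
      exact Finset.inf_le (f := fun i => P.rhoDown (P.phiDown (e i)) - nuDown (c i)) hi

end FilteredMatchedPair

theorem theorem1p1 {κ : Type*} [Field κ] {Γ : AddSubgroup ℝ} (hΓ : Γ.FG)
    {H Vup Vdown : Type*}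
    [AddCommGroup H] [Module (FMP.Lam κ Γ) H] [Module.Finite (FMP.Lam κ Γ) H]
    [AddCommGroup Vup] [Module (FMP.Lam κ Γ) Vup] [Module (FMP.LamUp κ Γ) Vup]
    [IsScalarTower (FMP.Lam κ Γ) (FMP.LamUp κ Γ) Vup] [Module.Finite (FMP.LamUp κ Γ) Vup]
    [AddCommGroup Vdown] [Module (FMP.Lam κ Γ) Vdown] [Module (FMP.LamDown κ Γ) Vdown]
    [IsScalarTower (FMP.Lam κ Γ) (FMP.LamDown κ Γ) Vdown]
    [Module.Finite (FMP.LamDown κ Γ) Vdown]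
    (P Q : FilteredMatchedPair κ Γ H Vup Vdown)
    (hphiUp : Q.phiUp = P.phiUp) (hphiDown : Q.phiDown = P.phiDown)
    (t : ℝ)
    (hUp : ∀ x : Vup, x ≠ 0 → |(P.rhoUp x).toReal - (Q.rhoUp x).toReal| ≤ t)
    (hDown : ∀ x : Vdown, x ≠ 0 → |(P.rhoDown x).toReal - (Q.rhoDown x).toReal| ≤ t) :
    (∀ i : ℕ, 1 ≤ i → i ≤ FMP.rank κ Γ H →
      IsLUB (P.gapSet i) (P.gap i) ∧ IsLUB (Q.gapSet i) (Q.gap i) ∧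
        |P.gap i - Q.gap i| ≤ 2 * t) ∧
    (DiscreteTopology Γ →
      P.HasBasisSpectrum ∧ Q.HasBasisSpectrum ∧
        Multiset.Rel (FMP.Close t) P.basisSpectrum Q.basisSpectrum) := by
  refine ⟨fun i h1 hi => ⟨P.isLUB_gap h1 hi, Q.isLUB_gap h1 hi,
    FilteredMatchedPair.abs_gap_sub_le hphiUp hphiDown hUp hDown h1 hi⟩, fun _ => ?_⟩
  have hP := FilteredMatchedPair.hasBasisSpectrum_of_exists P.exists_isDoublyOrthogonalBasis
  have hQ := FilteredMatchedPair.hasBasisSpectrum_of_exists Q.exists_isDoublyOrthogonalBasis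
  obtain ⟨e, he⟩ := hP.1
  obtain ⟨f, hf⟩ := hQ.1
  refine ⟨hP, hQ, ?_⟩
  rw [← hP.2 e he, ← hQ.2 f hf]
  exact FilteredMatchedPair.rel_close_spectrumOf he hf hphiUp hphiDown hUp hDown
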